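/- Model of computation. Programs are written in a first-order nested data-parallel language on a real-number machine. Values are natural numbers, real numbers, pairs and (nested) arrays. The primitive operations are: integer arithmetic and comparison, real arithmetic and comparison, conversion of an integer to a real (but not conversely), forming and projecting pairs, array length and array lookup, reading a cell of a random tape whose cells hold independent standard Gaussians, variable lookup, natural-number literals, conditionals, let-binding and while-loops. Each primitive operation contributes one unit of work and one unit of depth. The only parallel construct is the parallel array comprehension, which evaluates an expression for all $x\in\{0,\dots,N-1\}$ simultaneously: it adds the works of the $N$ evaluations and takes the maximum of their depths (plus one unit of work and of depth for the operation itself). Everything else is sequential: works and depths add up. A sparse matrix is given by rows (respectively, by columns) as the array of its nonzero rows (columns), in increasing order, each with its index and with the array of its nonzero entries, in increasing order, each with its index. For real $n\times n$ matrices write $A\bullet B=\sum_{i,j}A_{ij}B_{ij}$, and let $\log=\log_2$. Theorem. For all $a,b\in\mathbb N$ there are a randomized algorithm bigDotExp (one program, of the above kind) and a constant $C>0$, depending only on $a$ and $b$, such that the following holds. Let $n\ge 2$, $0<\varepsilon\le\frac12$ and $\kappa\ge 1$; let $\Phi$ be a real symmetric positive semidefinite $n\times n$ matrix with $\|\Phi\|_2\le\kappa$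 and with exactly $p$ nonzero entries; for $i=1,\dots,n$ let $A_i=Q_iQ_i^{\top}$, where $Q_i$ is a real matrix with $n$ rows and any finite number of columns, and let $q$ be the total number of nonzero entries of $Q_1,\dots,Q_n$. Suppose that $q\le n^{a}$ and $n\le p+q$ (the latter holds, for example, whenever no $A_i$ is zero). Given $n$, $\varepsilon$, $\kappa$, the matrix $\Phi$ by rows and the matrices $Q_i$ by columns, bigDotExp outputs real numbers $x_1,\dots,x_n$ such that, with probability at least $1-n^{-b}$, $$(1-\varepsilon)\,\exp(\Phi)\bullet A_i\ \le\ x_i\ \le\ (1+\varepsilon)\,\exp(\Phi)\bullet A_i\qquad\text{for all } i=1,\dots,n,$$ and, for every outcome of its random choices, it has depth at most $$C\,\bigl(\kappa\,\log n\,\log(1/\varepsilon)+\log\log n\bigr)$$ and work at most $$C\,\frac1{\varepsilon^{2}}\bigl(\kappa\,\log(1/\varepsilon)\,p+q\bigr)\log n .$$ -/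

import Mathlib

/-! A work–depth model: a first-order nested data-parallel language on a real-number machine.
Every primitive operation costs one unit of work and one unit of depth; only `Expr.tab` creates
parallelism. The machine has no conversion from reals to naturals. -/

namespace WorkDepth

/-- Values: natural numbers, real numbers, pairs, and (nested) arrays. -/
inductive Val : Type
  | nat (k : ℕ) : Val
  | real (x : ℝ) : Val
  | pair (u v : Val) : Val
  | arr (N : ℕ) (f : Fin N → Val) : Val

/-- Operations on natural numbers; `lt` returns `1` or `0`. -/
inductive NatOp : Type
  | add | sub | mul | div | lt

/-- Arithmetic operations on real numbers. -/
inductive RealOp : Type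
  | add | sub | mul | div

/-- The function computed by an operation on natural numbers. -/
def NatOp.den : NatOp → ℕ → ℕ → ℕ
  | .add, a, b => a + b
  | .sub, a, b => a - b
  | .mul, a, b => a * b
  | .div, a, b => a / b
  | .lt, a, b => if a < b then 1 else 0

/-- The function computed by an arithmetic operation on real numbers. -/
noncomputable def RealOp.den : RealOp → ℝ → ℝ → ℝ
  | .add, x, y => x + y
  | .sub, x, y => x - y
  | .mul, x, y => x * y
  | .div, x, y => x / y

/-- Programs. Variables are de Bruijn indices into the environment (a list of values);
`letE`, `tab` and `whileE` use variable `0` as their bound variable. -/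
inductive Expr : Type
  /-- the `i`-th variable -/
  | var (i : ℕ) : Expr
  /-- a natural-number literal -/
  | lit (k : ℕ) : Expr
  /-- arithmetic on natural numbers -/
  | natOp (o : NatOp) (e₁ e₂ : Expr) : Expr
  /-- arithmetic on real numbers -/
  | realOp (o : RealOp) (e₁ e₂ : Expr) : Expr
  /-- the comparison `e₁ ≤ e₂` of real numbers, with value `1` or `0` -/
  | realLe (e₁ e₂ : Expr) : Expr
  /-- a natural number as a real number -/
  | cast (e : Expr) : Expr
  /-- formation of pairs -/
  | pair (e₁ e₂ : Expr) : Expr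
  /-- first component -/
  | fst (e : Expr) : Expr
  /-- second component -/
  | snd (e : Expr) : Expr
  /-- length of an array -/
  | len (e : Expr) : Expr
  /-- entry `e₂` of the array `e₁` -/
  | get (e₁ e₂ : Expr) : Expr
  /-- cell `e` of the random tape, whose cells hold independent standard Gaussians -/
  | gauss (e : Expr) : Expr
  /-- conditional on a natural number being nonzero -/
  | ite (c e₁ e₂ : Expr) : Expr
  /-- `let x := e; body` -/
  | letE (e body : Expr) : Expr
  /-- in parallel for all `x < e`, evaluate `body`; the result is the array of the values -/
  | tab (e body : Expr) : Expr
  /-- `while c do x := body`, where `x` is the innermost variable; the result is the final `x` -/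
  | whileE (c body : Expr) : Expr

/-- `Eval ω e σ v w d`: with random tape `ω`, the program `e` in environment `σ` terminates
without error with value `v`, using work `w` and depth `d`. Ill-typed operations and
out-of-range accesses are errors. -/
inductive Eval (ω : ℕ → ℝ) : Expr → List Val → Val → ℕ → ℕ → Prop
  | var {i : ℕ} {σ : List Val} {v : Val} (h : σ[i]? = some v) : Eval ω (.var i) σ v 1 1
  | lit {k : ℕ} {σ : List Val} : Eval ω (.lit k) σ (.nat k) 1 1
  | natOp {o : NatOp} {e₁ e₂ : Expr} {σ : List Val} {a b w₁ w₂ d₁ d₂ : ℕ}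
      (h₁ : Eval ω e₁ σ (.nat a) w₁ d₁) (h₂ : Eval ω e₂ σ (.nat b) w₂ d₂) :
      Eval ω (.natOp o e₁ e₂) σ (.nat (o.den a b)) (1 + w₁ + w₂) (1 + d₁ + d₂)
  | realOp {o : RealOp} {e₁ e₂ : Expr} {σ : List Val} {x y : ℝ} {w₁ w₂ d₁ d₂ : ℕ}
      (h₁ : Eval ω e₁ σ (.real x) w₁ d₁) (h₂ : Eval ω e₂ σ (.real y) w₂ d₂) :
      Eval ω (.realOp o e₁ e₂) σ (.real (o.den x y)) (1 + w₁ + w₂) (1 + d₁ + d₂)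
  | realLe_true {e₁ e₂ : Expr} {σ : List Val} {x y : ℝ} {w₁ w₂ d₁ d₂ : ℕ}
      (h₁ : Eval ω e₁ σ (.real x) w₁ d₁) (h₂ : Eval ω e₂ σ (.real y) w₂ d₂) (h : x ≤ y) :
      Eval ω (.realLe e₁ e₂) σ (.nat 1) (1 + w₁ + w₂) (1 + d₁ + d₂)
  | realLe_false {e₁ e₂ : Expr} {σ : List Val} {x y : ℝ} {w₁ w₂ d₁ d₂ : ℕ}
      (h₁ : Eval ω e₁ σ (.real x) w₁ d₁) (h₂ : Eval ω e₂ σ (.real y) w₂ d₂) (h : ¬ x ≤ y) :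
      Eval ω (.realLe e₁ e₂) σ (.nat 0) (1 + w₁ + w₂) (1 + d₁ + d₂)
  | cast {e : Expr} {σ : List Val} {a w d : ℕ} (h : Eval ω e σ (.nat a) w d) :
      Eval ω (.cast e) σ (.real (a : ℝ)) (1 + w) (1 + d)
  | pair {e₁ e₂ : Expr} {σ : List Val} {u v : Val} {w₁ w₂ d₁ d₂ : ℕ}
      (h₁ : Eval ω e₁ σ u w₁ d₁) (h₂ : Eval ω e₂ σ v w₂ d₂) :
      Eval ω (.pair e₁ e₂) σ (.pair u v) (1 + w₁ + w₂) (1 + d₁ + d₂)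
  | fst {e : Expr} {σ : List Val} {u v : Val} {w d : ℕ} (h : Eval ω e σ (.pair u v) w d) :
      Eval ω (.fst e) σ u (1 + w) (1 + d)
  | snd {e : Expr} {σ : List Val} {u v : Val} {w d : ℕ} (h : Eval ω e σ (.pair u v) w d) :
      Eval ω (.snd e) σ v (1 + w) (1 + d)
  | len {e : Expr} {σ : List Val} {N w d : ℕ} {f : Fin N → Val}
      (h : Eval ω e σ (.arr N f) w d) :
      Eval ω (.len e) σ (.nat N) (1 + w) (1 + d)
  | get {e₁ e₂ : Expr} {σ : List Val} {N i : ℕ} {f : Fin N → Val} {w₁ w₂ d₁ d₂ : ℕ}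
      (h₁ : Eval ω e₁ σ (.arr N f) w₁ d₁) (h₂ : Eval ω e₂ σ (.nat i) w₂ d₂) (hi : i < N) :
      Eval ω (.get e₁ e₂) σ (f ⟨i, hi⟩) (1 + w₁ + w₂) (1 + d₁ + d₂)
  | gauss {e : Expr} {σ : List Val} {a w d : ℕ} (h : Eval ω e σ (.nat a) w d) :
      Eval ω (.gauss e) σ (.real (ω a)) (1 + w) (1 + d)
  | ite_true {c e₁ e₂ : Expr} {σ : List Val} {v : Val} {a w d w' d' : ℕ}
      (hc : Eval ω c σ (.nat a) w d) (ha : a ≠ 0) (h : Eval ω e₁ σ v w' d') :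
      Eval ω (.ite c e₁ e₂) σ v (1 + w + w') (1 + d + d')
  | ite_false {c e₁ e₂ : Expr} {σ : List Val} {v : Val} {w d w' d' : ℕ}
      (hc : Eval ω c σ (.nat 0) w d) (h : Eval ω e₂ σ v w' d') :
      Eval ω (.ite c e₁ e₂) σ v (1 + w + w') (1 + d + d')
  | letE {e body : Expr} {σ : List Val} {u v : Val} {w d w' d' : ℕ}
      (h₁ : Eval ω e σ u w d) (h₂ : Eval ω body (u :: σ) v w' d') :
      Eval ω (.letE e body) σ v (1 + w + w') (1 + d + d')
  | tab {e body : Expr} {σ : List Val} {N w d : ℕ} {f : Fin N → Val} {w' d' : Fin N → ℕ}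
      (h₁ : Eval ω e σ (.nat N) w d)
      (h₂ : ∀ i : Fin N, Eval ω body (.nat (i : ℕ) :: σ) (f i) (w' i) (d' i)) :
      Eval ω (.tab e body) σ (.arr N f) (1 + w + ∑ i, w' i) (1 + d + Finset.univ.sup d')
  | while_done {c body : Expr} {σ : List Val} {x : Val} {w d : ℕ}
      (hc : Eval ω c (x :: σ) (.nat 0) w d) :
      Eval ω (.whileE c body) (x :: σ) x (1 + w) (1 + d)
  | while_step {c body : Expr} {σ : List Val} {x y v : Val} {a w d w₁ d₁ w₂ d₂ : ℕ}
      (hc : Eval ω c (x :: σ) (.nat a) w d) (ha : a ≠ 0)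
      (h₁ : Eval ω body (x :: σ) y w₁ d₁)
      (h₂ : Eval ω (.whileE c body) (y :: σ) v w₂ d₂) :
      Eval ω (.whileE c body) (x :: σ) v (1 + w + w₁ + w₂) (1 + d + d₁ + d₂)

/-- Evaluation is deterministic: value, work and depth are functions of program, input, tape. -/
theorem Eval.deterministic {ω : ℕ → ℝ} {e : Expr} {σ : List Val} {v : Val} {w d : ℕ}
    (h : Eval ω e σ v w d) :
    ∀ {v' : Val} {w' d' : ℕ}, Eval ω e σ v' w' d' → v = v' ∧ w = w' ∧ d = d' := by
  induction h with
  | tab h1 h2 ih1 ih2 =>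
    intro v' w' d' h
    cases h with
    | tab g1 g2 =>
      obtain ⟨a, rfl, rfl⟩ := ih1 g1
      cases a
      have := fun i => ih2 i (g2 i)
      obtain rfl := funext fun i => (this i).1
      obtain rfl := funext fun i => (this i).2.1
      obtain rfl := funext fun i => (this i).2.2
      simp
  | get h1 h2 hi ih1 ih2 =>
    intro v' w' d' h
    cases h with
    | get g1 g2 hi' =>
      obtain ⟨a, rfl, rfl⟩ := ih1 g1
      obtain ⟨b, rfl, rfl⟩ := ih2 g2
      cases a
      cases b
      simp
  | _ =>
    intro v' w' d' h
    cases h <;> grind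

/-- The law of the random tape: independent standard Gaussians. -/
noncomputable def tapeLaw : MeasureTheory.Measure (ℕ → ℝ) :=
  MeasureTheory.Measure.infinitePi fun _ : ℕ => ProbabilityTheory.gaussianReal 0 1

/-- A list of values as an array. -/
def Val.ofList (l : List Val) : Val := .arr l.length l.get

/-- A sparse vector: the array, by increasing index `j`, of the pairs `(j, x j)` with
`x j ≠ 0`. -/
noncomputable def sparseVec {m : ℕ} (x : Fin m → ℝ) : Val :=
  .ofList (((List.finRange m).filter fun j : Fin m => x j ≠ 0).map
    fun j : Fin m => .pair (.nat (j : ℕ)) (.real (x j)))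

/-- A sparse matrix by rows: the array, by increasing index `i`, of the pairs consisting of `i`
and the sparse vector `M i`, for the rows with `M i ≠ 0`. -/
noncomputable def sparseRows {m n : ℕ} (M : Matrix (Fin m) (Fin n) ℝ) : Val :=
  .ofList (((List.finRange m).filter fun i : Fin m => M i ≠ 0).map
    fun i : Fin m => .pair (.nat (i : ℕ)) (sparseVec (M i)))

/-- The input of the computation: `n`, the accuracy `ε`, the norm bound `κ`, the sparse matrix
`Φ` by rows, and the array of the sparse matrices `Q i` by columns. -/
noncomputable def dotExpInput {n : ℕ} (ε κ : ℝ) (Φ : Matrix (Fin n) (Fin n) ℝ) {r : Fin n → ℕ}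
    (Q : (i : Fin n) → Matrix (Fin n) (Fin (r i)) ℝ) : List Val :=
  [.nat n, .real ε, .real κ, sparseRows Φ, .arr n fun i => sparseRows (Q i).transpose]

/-- The number of nonzero entries of a matrix. -/
noncomputable def nnz {m n : ℕ} (M : Matrix (Fin m) (Fin n) ℝ) : ℕ :=
  (Finset.univ.filter fun ij : Fin m × Fin n => M ij.1 ij.2 ≠ 0).card

/-- The matrix dot product, the sum of the products of corresponding entries. -/
def matDot {n : ℕ} (A B : Matrix (Fin n) (Fin n) ℝ) : ℝ := ∑ i, ∑ j, A i j * B i j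

end WorkDepth

/-! Since `A_i` is a sum of `x xᵀ` over the columns `x` of `Q_i`, the number `exp Φ • A_i` is the
sum of the squared lengths `|exp(Φ/2) x|²`. Two approximations make these cheap.

Taylor: the eigenvalues of `Φ/2` lie in `[0, κ/2]`, where the Taylor polynomial of degree `k` has
relative error at most `2^(-k)` once `k ≥ 4κ` (`exp_le_taylorExp`). Diagonalisation carries this
over to quadratic forms (`exists_taylorVec_dual`), so a degree of order `κ log(1/ε)` suffices.

Sketching: let `P` be the polynomial evaluated at `Φ/2`. It is symmetric, so `⟨x, P g⟩ = ⟨P x, g⟩`,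
which for a standard Gaussian vector `g` has variance `|P x|²`. The mean of `⟨x, P g_l⟩²` over `m`
independent vectors is within a factor `1 ± ε/2` of `|P x|²` except with probability `2 exp(-m
ε²/64)` (`tape_sketch_tail`). A union bound over the at most `q ≤ n^a` nonzero columns
(`sketchDot_tail`) allows `m` of order `log n / ε²`.

Cost: `P` is applied only to the `m` sketch vectors, by `k` steps of Horner's rule of work `O(p)`
and depth `O(log n)`; then each nonzero entry of the `Q_i` is used once per sketch vector. To avoid
paying `n` in every step, the iterates are stored only on the nonzero rows of `Φ`. By symmetry these
are also its nonzero columns, and elsewhere `P g` agrees with `g` (`Runs.sketchE`). A table of row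
positions, built by binary search, translates indices. Costs proportional to `n` are absorbed
through `n ≤ p + q`. As reals cannot be converted to naturals, `k` and `m` are built from powers of
two found by repeated doubling, which loses constant factors only. -/

namespace WorkDepth

/-! ### A calculus of upper bounds for work and depth. -/

/-- `Runs ω e σ v W D`: the program `e` evaluates to `v` with work at most `W` and depth at
most `D`. -/
def Runs (ω : ℕ → ℝ) (e : Expr) (σ : List Val) (v : Val) (W D : ℕ) : Prop :=
  ∃ w d, Eval ω e σ v w d ∧ w ≤ W ∧ d ≤ D

namespace Runs

variable {ω : ℕ → ℝ} {σ : List Val}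

theorem conv {e : Expr} {v v' : Val} {W D W' D' : ℕ} (h : Runs ω e σ v W D) (hv : v = v')
    (hW : W ≤ W') (hD : D ≤ D') : Runs ω e σ v' W' D' := by
  subst hv
  obtain ⟨w, d, h, hw, hd⟩ := h
  exact ⟨w, d, h, hw.trans hW, hd.trans hD⟩

theorem mono {e : Expr} {v : Val} {W D W' D' : ℕ} (h : Runs ω e σ v W D)
    (hW : W ≤ W') (hD : D ≤ D') : Runs ω e σ v W' D' := h.conv rfl hW hD

theorem var {i : ℕ} {v : Val} (h : σ[i]? = some v) : Runs ω (.var i) σ v 1 1 :=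
  ⟨1, 1, .var h, le_rfl, le_rfl⟩

theorem lit {k : ℕ} : Runs ω (.lit k) σ (.nat k) 1 1 := ⟨1, 1, .lit, le_rfl, le_rfl⟩

theorem natOp {o : NatOp} {e₁ e₂ : Expr} {a b W₁ W₂ D₁ D₂ : ℕ}
    (h₁ : Runs ω e₁ σ (.nat a) W₁ D₁) (h₂ : Runs ω e₂ σ (.nat b) W₂ D₂) :
    Runs ω (.natOp o e₁ e₂) σ (.nat (o.den a b)) (1 + W₁ + W₂) (1 + D₁ + D₂) := by
  obtain ⟨w₁, d₁, h₁, hw₁, hd₁⟩ := h₁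
  obtain ⟨w₂, d₂, h₂, hw₂, hd₂⟩ := h₂
  exact ⟨_, _, .natOp h₁ h₂, by omega, by omega⟩

theorem realOp {o : RealOp} {e₁ e₂ : Expr} {x y : ℝ} {W₁ W₂ D₁ D₂ : ℕ}
    (h₁ : Runs ω e₁ σ (.real x) W₁ D₁) (h₂ : Runs ω e₂ σ (.real y) W₂ D₂) :
    Runs ω (.realOp o e₁ e₂) σ (.real (o.den x y)) (1 + W₁ + W₂) (1 + D₁ + D₂) := by
  obtain ⟨w₁, d₁, h₁, hw₁, hd₁⟩ := h₁
  obtain ⟨w₂, d₂, h₂, hw₂, hd₂⟩ := h₂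
  exact ⟨_, _, .realOp h₁ h₂, by omega, by omega⟩

open Classical in
theorem realLe {e₁ e₂ : Expr} {x y : ℝ} {W₁ W₂ D₁ D₂ : ℕ}
    (h₁ : Runs ω e₁ σ (.real x) W₁ D₁) (h₂ : Runs ω e₂ σ (.real y) W₂ D₂) :
    Runs ω (.realLe e₁ e₂) σ (.nat (if x ≤ y then 1 else 0)) (1 + W₁ + W₂) (1 + D₁ + D₂) := by
  obtain ⟨w₁, d₁, h₁, hw₁, hd₁⟩ := h₁
  obtain ⟨w₂, d₂, h₂, hw₂, hd₂⟩ := h₂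
  split_ifs with h
  · exact ⟨_, _, .realLe_true h₁ h₂ h, by omega, by omega⟩
  · exact ⟨_, _, .realLe_false h₁ h₂ h, by omega, by omega⟩

theorem cast {e : Expr} {a W D : ℕ} (h : Runs ω e σ (.nat a) W D) :
    Runs ω (.cast e) σ (.real (a : ℝ)) (1 + W) (1 + D) := by
  obtain ⟨w, d, h, hw, hd⟩ := h
  exact ⟨_, _, .cast h, by omega, by omega⟩

theorem pair {e₁ e₂ : Expr} {u v : Val} {W₁ W₂ D₁ D₂ : ℕ}
    (h₁ : Runs ω e₁ σ u W₁ D₁) (h₂ : Runs ω e₂ σ v W₂ D₂) :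
    Runs ω (.pair e₁ e₂) σ (.pair u v) (1 + W₁ + W₂) (1 + D₁ + D₂) := by
  obtain ⟨w₁, d₁, h₁, hw₁, hd₁⟩ := h₁
  obtain ⟨w₂, d₂, h₂, hw₂, hd₂⟩ := h₂
  exact ⟨_, _, .pair h₁ h₂, by omega, by omega⟩

theorem fst {e : Expr} {u v : Val} {W D : ℕ} (h : Runs ω e σ (.pair u v) W D) :
    Runs ω (.fst e) σ u (1 + W) (1 + D) := by
  obtain ⟨w, d, h, hw, hd⟩ := h
  exact ⟨_, _, .fst h, by omega, by omega⟩

theorem snd {e : Expr} {u v : Val} {W D : ℕ} (h : Runs ω e σ (.pair u v) W D) :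
    Runs ω (.snd e) σ v (1 + W) (1 + D) := by
  obtain ⟨w, d, h, hw, hd⟩ := h
  exact ⟨_, _, .snd h, by omega, by omega⟩

theorem len {e : Expr} {N W D : ℕ} {f : Fin N → Val} (h : Runs ω e σ (.arr N f) W D) :
    Runs ω (.len e) σ (.nat N) (1 + W) (1 + D) := by
  obtain ⟨w, d, h, hw, hd⟩ := h
  exact ⟨_, _, .len h, by omega, by omega⟩

theorem get {e₁ e₂ : Expr} {N i W₁ W₂ D₁ D₂ : ℕ} {f : Fin N → Val}
    (h₁ : Runs ω e₁ σ (.arr N f) W₁ D₁) (h₂ : Runs ω e₂ σ (.nat i) W₂ D₂) (hi : i < N) :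
    Runs ω (.get e₁ e₂) σ (f ⟨i, hi⟩) (1 + W₁ + W₂) (1 + D₁ + D₂) := by
  obtain ⟨w₁, d₁, h₁, hw₁, hd₁⟩ := h₁
  obtain ⟨w₂, d₂, h₂, hw₂, hd₂⟩ := h₂
  exact ⟨_, _, .get h₁ h₂ hi, by omega, by omega⟩

theorem get_of_eq {e₁ e₂ : Expr} {N i W₁ W₂ D₁ D₂ : ℕ} {f : Fin N → Val} {v : Val}
    (h₁ : Runs ω e₁ σ (.arr N f) W₁ D₁) (h₂ : Runs ω e₂ σ (.nat i) W₂ D₂) (hi : i < N)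
    (hv : f ⟨i, hi⟩ = v) : Runs ω (.get e₁ e₂) σ v (1 + W₁ + W₂) (1 + D₁ + D₂) :=
  hv ▸ get h₁ h₂ hi

theorem gauss {e : Expr} {a W D : ℕ} (h : Runs ω e σ (.nat a) W D) :
    Runs ω (.gauss e) σ (.real (ω a)) (1 + W) (1 + D) := by
  obtain ⟨w, d, h, hw, hd⟩ := h
  exact ⟨_, _, .gauss h, by omega, by omega⟩

theorem ite {c e₁ e₂ : Expr} {v : Val} {a W D W' D' : ℕ}
    (hc : Runs ω c σ (.nat a) W D) (h₁ : a ≠ 0 → Runs ω e₁ σ v W' D')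
    (h₂ : a = 0 → Runs ω e₂ σ v W' D') :
    Runs ω (.ite c e₁ e₂) σ v (1 + W + W') (1 + D + D') := by
  obtain ⟨w, d, hc, hw, hd⟩ := hc
  by_cases ha : a = 0
  · obtain ⟨w', d', h, hw', hd'⟩ := h₂ ha
    subst ha
    exact ⟨_, _, .ite_false hc h, by omega, by omega⟩
  · obtain ⟨w', d', h, hw', hd'⟩ := h₁ ha
    exact ⟨_, _, .ite_true hc ha h, by omega, by omega⟩

theorem letE {e body : Expr} {u v : Val} {W D W' D' : ℕ}
    (h₁ : Runs ω e σ u W D) (h₂ : Runs ω body (u :: σ) v W' D') :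
    Runs ω (.letE e body) σ v (1 + W + W') (1 + D + D') := by
  obtain ⟨w₁, d₁, h₁, hw₁, hd₁⟩ := h₁
  obtain ⟨w₂, d₂, h₂, hw₂, hd₂⟩ := h₂
  exact ⟨_, _, .letE h₁ h₂, by omega, by omega⟩

theorem tab {e body : Expr} {N W D D' : ℕ} {f : Fin N → Val} {W' : Fin N → ℕ}
    (h₁ : Runs ω e σ (.nat N) W D)
    (h₂ : ∀ i : Fin N, Runs ω body (.nat (i : ℕ) :: σ) (f i) (W' i) D') :
    Runs ω (.tab e body) σ (.arr N f) (1 + W + ∑ i, W' i) (1 + D + D') := by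
  obtain ⟨w, d, h₁, hw, hd⟩ := h₁
  choose w' d' h₂ hw' hd' using h₂
  refine ⟨_, _, .tab h₁ h₂, ?_, ?_⟩
  · have := Finset.sum_le_sum fun i (_ : i ∈ Finset.univ) => hw' i
    omega
  · have : Finset.univ.sup d' ≤ D' := Finset.sup_le fun i _ => hd' i
    omega

theorem tab_const {e body : Expr} {N W D W' D' : ℕ} {f : Fin N → Val}
    (h₁ : Runs ω e σ (.nat N) W D)
    (h₂ : ∀ i : Fin N, Runs ω body (.nat (i : ℕ) :: σ) (f i) W' D') :
    Runs ω (.tab e body) σ (.arr N f) (1 + W + N * W') (1 + D + D') :=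
  (tab (W' := fun _ => W') h₁ h₂).mono (by simp) le_rfl

theorem while_done {c body : Expr} {x : Val} {W D : ℕ} (hc : Runs ω c (x :: σ) (.nat 0) W D) :
    Runs ω (.whileE c body) (x :: σ) x (1 + W) (1 + D) := by
  obtain ⟨w, d, h, hw, hd⟩ := hc
  exact ⟨_, _, .while_done h, by omega, by omega⟩

theorem while_step {c body : Expr} {x y v : Val} {a W D W₁ D₁ W₂ D₂ : ℕ}
    (hc : Runs ω c (x :: σ) (.nat a) W D) (ha : a ≠ 0)
    (h₁ : Runs ω body (x :: σ) y W₁ D₁) (h₂ : Runs ω (.whileE c body) (y :: σ) v W₂ D₂) :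
    Runs ω (.whileE c body) (x :: σ) v (1 + W + W₁ + W₂) (1 + D + D₁ + D₂) := by
  obtain ⟨w, d, hc, hw, hd⟩ := hc
  obtain ⟨w₁, d₁, h₁, hw₁, hd₁⟩ := h₁
  obtain ⟨w₂, d₂, h₂, hw₂, hd₂⟩ := h₂
  exact ⟨_, _, .while_step hc ha h₁ h₂, by omega, by omega⟩

/-- A loop that passes through the states `x 0, …, x N`. -/
theorem while_iterate {c body : Expr} (x : ℕ → Val) (N : ℕ) {W D W' D' : ℕ}
    (hc : ∀ t < N, ∃ a ≠ 0, Runs ω c (x t :: σ) (.nat a) W D)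
    (hN : Runs ω c (x N :: σ) (.nat 0) W D)
    (hb : ∀ t < N, Runs ω body (x t :: σ) (x (t + 1)) W' D') :
    Runs ω (.whileE c body) (x 0 :: σ) (x N) (1 + W + N * (1 + W + W'))
      (1 + D + N * (1 + D + D')) := by
  have key : ∀ j ≤ N, Runs ω (.whileE c body) (x (N - j) :: σ) (x N) (1 + W + j * (1 + W + W'))
      (1 + D + j * (1 + D + D')) := by
    intro j
    induction j with
    | zero => intro _; simpa using while_done hN
    | succ j ih =>
      intro hj
      obtain ⟨a, ha, h⟩ := hc (N - (j + 1)) (by omega)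
      have hs := hb (N - (j + 1)) (by omega)
      rw [show N - (j + 1) + 1 = N - j by omega] at hs
      refine (while_step h ha hs (ih (by omega))).mono ?_ ?_ <;> · rw [Nat.succ_mul]; omega
  simpa using key N le_rfl

end Runs

/-! ### Rounding up to powers of two, and summation in logarithmic depth. -/

/-- The least power of two `2 ^ T` with `y ≤ 2 ^ T`, for a real number `y` in variable `0`;
the result is the pair of `T` and `2 ^ T`. -/
def powTwoCeil : Expr :=
  .letE (.pair (.lit 0) (.lit 1))
    (.whileE (.ite (.realLe (.var 1) (.cast (.snd (.var 0)))) (.lit 0) (.lit 1))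
      (.pair (.natOp .add (.fst (.var 0)) (.lit 1)) (.natOp .mul (.lit 2) (.snd (.var 0)))))

/-- The least `T` with `y ≤ 2 ^ T`. -/
noncomputable def clogReal (y : ℝ) : ℕ := Nat.clog 2 ⌈y⌉₊

theorem le_two_pow_clogReal (y : ℝ) : y ≤ 2 ^ clogReal y := by
  have h : ⌈y⌉₊ ≤ 2 ^ clogReal y := Nat.le_pow_clog (by norm_num) _
  calc y ≤ (⌈y⌉₊ : ℝ) := Nat.le_ceil y
    _ ≤ ((2 ^ clogReal y : ℕ) : ℝ) := by exact_mod_cast h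
    _ = _ := by push_cast; rfl

theorem two_pow_lt_of_lt_clogReal {y : ℝ} {t : ℕ} (h : t < clogReal y) : (2 : ℝ) ^ t < y := by
  have h' : 2 ^ t < ⌈y⌉₊ := (Nat.lt_clog_iff_pow_lt (by norm_num)).1 h
  have := Nat.lt_ceil.1 h'
  push_cast at this
  exact this

theorem Runs.powTwoCeil {ω : ℕ → ℝ} {σ : List Val} (y : ℝ) :
    Runs ω powTwoCeil (.real y :: σ) (.pair (.nat (clogReal y)) (.nat (2 ^ clogReal y)))
      (20 * clogReal y + 12) (20 * clogReal y + 12) := by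
  have hc (t : ℕ) : Runs ω (.ite (.realLe (.var 1) (.cast (.snd (.var 0)))) (.lit 0) (.lit 1))
      (.pair (.nat t) (.nat (2 ^ t)) :: .real y :: σ)
      (.nat (if y ≤ 2 ^ t then 0 else 1)) 7 7 := by
    refine (Runs.ite (W' := 1) (D' := 1) (.realLe (.var rfl) (.cast (.snd (.var rfl))))
      (fun h => ?_) (fun h => ?_)).mono (by omega) (by omega)
    · refine Runs.lit.conv ?_ le_rfl le_rfl
      have : y ≤ 2 ^ t := by by_contra h'; simp [h'] at h
      simp [this]
    · refine Runs.lit.conv ?_ le_rfl le_rfl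
      have : ¬ y ≤ 2 ^ t := by intro h'; simp [h'] at h
      simp [this]
  have hw := Runs.while_iterate (σ := .real y :: σ)
    (body := .pair (.natOp .add (.fst (.var 0)) (.lit 1)) (.natOp .mul (.lit 2) (.snd (.var 0))))
    (W' := 9) (D' := 9)
    (fun t => .pair (.nat t) (.nat (2 ^ t))) (clogReal y) (fun t ht => ⟨1, one_ne_zero, ?_⟩)
    ((hc _).conv ?_ le_rfl le_rfl) (fun t _ => ?_)
  · exact (Runs.letE (.pair .lit .lit) hw).mono (by omega) (by omega)
  · refine (hc t).conv ?_ le_rfl le_rfl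
    simp [two_pow_lt_of_lt_clogReal ht]
  · simp [le_two_pow_clogReal]
  · refine (Runs.pair (.natOp (.fst (.var rfl)) .lit) (.natOp .lit (.snd (.var rfl)))).conv ?_
      (by omega) (by omega)
    simp [NatOp.den, pow_succ']

/-- The sum of the array of real numbers in variable `0`, by pairwise summation. -/
def treeSum : Expr :=
  .ite (.len (.var 0))
    (.get (.whileE (.natOp .lt (.lit 1) (.len (.var 0)))
      (.tab (.natOp .div (.natOp .add (.len (.var 0)) (.lit 1)) (.lit 2))
        (.realOp .add (.get (.var 1) (.natOp .mul (.lit 2) (.var 0)))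
          (.ite (.natOp .lt (.natOp .add (.natOp .mul (.lit 2) (.var 0)) (.lit 1)) (.len (.var 1)))
            (.get (.var 1) (.natOp .add (.natOp .mul (.lit 2) (.var 0)) (.lit 1)))
            (.cast (.lit 0)))))) (.lit 0))
    (.cast (.lit 0))

theorem sum_range_pairs (f : ℕ → ℝ) (N : ℕ) :
    ∑ i ∈ Finset.range ((N + 1) / 2), (f (2 * i) + if 2 * i + 1 < N then f (2 * i + 1) else 0) =
      ∑ i ∈ Finset.range N, f i := by
  have even (M : ℕ) : ∑ i ∈ Finset.range (2 * M), f i =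
      ∑ i ∈ Finset.range M, (f (2 * i) + f (2 * i + 1)) := by
    induction M with
    | zero => simp
    | succ M ih => rw [Finset.sum_range_succ, ← ih, mul_add, mul_one, Finset.sum_range_succ,
        Finset.sum_range_succ, add_assoc]
  obtain ⟨M, rfl | rfl⟩ := Nat.even_or_odd' N
  · rw [even, show (2 * M + 1) / 2 = M by omega]
    refine Finset.sum_congr rfl fun i hi => ?_
    rw [if_pos (by have := Finset.mem_range.1 hi; omega)]
  · rw [Finset.sum_range_succ, even, show (2 * M + 1 + 1) / 2 = M + 1 by omega,
      Finset.sum_range_succ, if_neg (by omega), add_zero]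
    refine congrArg (· + _) (Finset.sum_congr rfl fun i hi => ?_)
    rw [if_pos (by have := Finset.mem_range.1 hi; omega)]

/-- Each round replaces the array by its pair sums, an unpaired last entry being paired with zero.
The lengths halve, so the works form a geometric series and stay linear, while each round adds
constant depth. Taking `f` on all of `ℕ` lets the induction hypothesis apply directly to the pair
sums. -/
theorem Runs.treeSum_range {ω : ℕ → ℝ} {σ : List Val} (N : ℕ) (f : ℕ → ℝ) :
    Runs ω treeSum (.arr N (fun i => .real (f i)) :: σ)
      (.real (∑ i ∈ Finset.range N, f i)) (100 * N + 20) (50 * Nat.clog 2 N + 20) := by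
  rcases Nat.eq_zero_or_pos N with rfl | hN
  · refine (Runs.ite (W' := 2) (D' := 2) (.len (.var rfl)) (fun h => absurd rfl h)
      (fun _ => Runs.cast .lit |>.conv ?_ le_rfl le_rfl)).mono (by omega) (by omega)
    simp
  refine Runs.mono (Runs.ite (W' := 100 * N + 10) (D' := 50 * Nat.clog 2 N + 10)
    (.len (.var rfl)) (fun _ => ?_) (fun h => absurd h hN.ne')) (by omega) (by omega)
  suffices h : Runs ω (.whileE (.natOp .lt (.lit 1) (.len (.var 0)))
      (.tab (.natOp .div (.natOp .add (.len (.var 0)) (.lit 1)) (.lit 2))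
        (.realOp .add (.get (.var 1) (.natOp .mul (.lit 2) (.var 0)))
          (.ite (.natOp .lt (.natOp .add (.natOp .mul (.lit 2) (.var 0)) (.lit 1)) (.len (.var 1)))
            (.get (.var 1) (.natOp .add (.natOp .mul (.lit 2) (.var 0)) (.lit 1)))
            (.cast (.lit 0)))))) (.arr N (fun i => .real (f i)) :: σ)
      (.arr 1 fun _ => .real (∑ i ∈ Finset.range N, f i)) (100 * N) (50 * Nat.clog 2 N + 5) from
    (Runs.get h .lit (by norm_num)).mono (by omega) (by omega)
  induction N using Nat.strong_induction_on generalizing f with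
  | _ N ih =>
    have hc : Runs ω (.natOp .lt (.lit 1) (.len (.var 0))) (.arr N (fun i => .real (f i)) :: σ)
        (.nat (if 1 < N then 1 else 0)) 4 4 :=
      (Runs.natOp .lit (.len (.var rfl))).conv rfl (by omega) (by omega)
    by_cases h1 : 1 < N
    · rw [if_pos h1] at hc
      have hb := ih ((N + 1) / 2) (by omega)
        (fun i => f (2 * i) + if 2 * i + 1 < N then f (2 * i + 1) else 0) (by omega)
      rw [sum_range_pairs] at hb
      replace hb := hb (by omega)
      refine (Runs.while_step (W₁ := 10 + (N + 1) / 2 * 30) (D₁ := 40) hc one_ne_zero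
        (Runs.mono (Runs.tab_const (N := (N + 1) / 2) (W := 6) (D := 6) (W' := 30) (D' := 30)
          ((Runs.natOp (.natOp (.len (.var rfl)) .lit) .lit).conv rfl le_rfl le_rfl)
          (fun i => ?_)) (by omega) (by omega)) hb).mono (by omega) ?_
      · have hi : (i : ℕ) < (N + 1) / 2 := i.2
        refine (Runs.realOp (W₁ := 6) (W₂ := 20) (D₁ := 6) (D₂ := 20)
          ((Runs.get (i := 2 * i) (.var rfl) (.natOp .lit (.var rfl)) (by omega)).conv rfl
            (by omega) (by omega))
          (Runs.mono (Runs.ite (W' := 7) (D' := 7)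
            ((Runs.natOp (.natOp (.natOp .lit (.var rfl)) .lit) (.len (.var rfl))).conv rfl
              le_rfl le_rfl)
            (fun h => ?_) (fun h => ?_)) (by omega) (by omega))).conv rfl (by omega) (by omega)
        · have h' : 2 * (i : ℕ) + 1 < N := by
            by_contra h'
            simp [NatOp.den, h'] at h
          refine (Runs.get (i := 2 * i + 1) (.var rfl)
            (.natOp (.natOp .lit (.var rfl)) .lit) h').conv ?_ (by omega) (by omega)
          simp [h']
        · have h' : ¬ 2 * (i : ℕ) + 1 < N := by
            intro h'
            simp [NatOp.den, h'] at h
          refine (Runs.cast .lit).conv ?_ (by omega) (by omega)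
          simp [h']
      · rw [Nat.clog_of_two_le one_lt_two h1]
        have : (N + 2 - 1) / 2 = (N + 1) / 2 := by omega
        rw [this]
        omega
    · obtain rfl : N = 1 := by omega
      refine (Runs.while_done hc).conv ?_ (by omega) (by omega)
      congr 1
      funext i
      simp

theorem Runs.treeSum {ω : ℕ → ℝ} {σ : List Val} {N : ℕ} (f : Fin N → ℝ) :
    Runs ω treeSum (.arr N (fun i => .real (f i)) :: σ)
      (.real (∑ i, f i)) (100 * N + 20) (50 * Nat.clog 2 N + 20) := by
  have h := Runs.treeSum_range (ω := ω) (σ := σ) N fun i => if h : i < N then f ⟨i, h⟩ else 0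
  rw [Finset.sum_range] at h
  simpa using h

end WorkDepth

/-! ### Taylor approximation of the matrix exponential. -/

namespace WorkDepth
open Matrix

/-- The Taylor polynomial of degree `k` of the exponential function. -/
noncomputable def taylorExp (k : ℕ) (x : ℝ) : ℝ :=
  ∑ i ∈ Finset.range (k + 1), x ^ i / (i.factorial : ℝ)

theorem taylorExp_nonneg (k : ℕ) {x : ℝ} (hx : 0 ≤ x) : 0 ≤ taylorExp k x :=
  Finset.sum_nonneg fun i _ => by positivity

theorem taylorExp_le_exp (k : ℕ) {x : ℝ} (hx : 0 ≤ x) : taylorExp k x ≤ Real.exp x :=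
  Real.sum_le_exp_of_nonneg hx _

/-- For `i > k` the term `x^i/i!` is at most `4^(-k) (4x)^i/i!`, so the remainder is at most `4^(-k)
exp(4x)`. As `4x ≤ k/2` and `exp(1/2) ≤ 2`, this is at most `2^(-k)`; `exp x ≥ 1` makes the error
relative. -/
theorem exp_le_taylorExp {k : ℕ} {x : ℝ} (hx : 0 ≤ x) (hk : 8 * x ≤ k) :
    (1 - (1 / 2) ^ k) * Real.exp x ≤ taylorExp k x := by
  have hs (y : ℝ) : HasSum (fun i : ℕ => y ^ i / (i.factorial : ℝ)) (Real.exp y) := by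
    rw [Real.exp_eq_exp_ℝ]
    exact NormedSpace.expSeries_div_hasSum_exp y
  have h1 := (hasSum_nat_add_iff' (k + 1)).2 (hs x)
  have h2 := (hasSum_nat_add_iff' (k + 1)).2 (hs (4 * x))
  have h3 := hasSum_le (fun i => ?_) h1 (h2.mul_left ((1 / 4 : ℝ) ^ k))
  · have hexp : Real.exp (4 * x) ≤ 2 ^ k := by
      have : Real.exp (1 / 2) ≤ 2 := by
        have h := Real.exp_bound' (x := 1 / 2) (by norm_num) (by norm_num) (n := 3) (by norm_num)
        refine h.trans ?_
        norm_num [Finset.sum_range_succ, Nat.factorial]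
      calc Real.exp (4 * x) ≤ Real.exp (k * (1 / 2)) := Real.exp_le_exp.2 (by linarith)
        _ = Real.exp (1 / 2) ^ k := Real.exp_nat_mul _ _
        _ ≤ 2 ^ k := by gcongr
    have hnn : 0 ≤ ∑ i ∈ Finset.range (k + 1), (4 * x) ^ i / (i.factorial : ℝ) :=
      Finset.sum_nonneg fun i _ => by positivity
    have h4 : (1 / 4 : ℝ) ^ k * (Real.exp (4 * x) -
        ∑ i ∈ Finset.range (k + 1), (4 * x) ^ i / (i.factorial : ℝ)) ≤ (1 / 2) ^ k := by
      calc _ ≤ (1 / 4 : ℝ) ^ k * 2 ^ k := by gcongr; linarith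
        _ = (1 / 2) ^ k := by rw [← mul_pow]; norm_num
    have h5 : (1 / 2 : ℝ) ^ k ≤ (1 / 2) ^ k * Real.exp x :=
      le_mul_of_one_le_right (by positivity) (Real.one_le_exp hx)
    unfold taylorExp
    linarith
  · rw [mul_pow, mul_div_assoc, ← mul_assoc]
    refine le_mul_of_one_le_left (by positivity) ?_
    rw [add_left_comm, pow_add, ← mul_assoc, ← mul_pow]
    norm_num
    exact one_le_pow₀ (by norm_num)

variable {n : ℕ}

/-- The vector `taylorExp k (Φ / 2) g`. -/
noncomputable def taylorVec (Φ : Matrix (Fin n) (Fin n) ℝ) (k : ℕ) (g : Fin n → ℝ) : Fin n → ℝ :=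
  ∑ i ∈ Finset.range (k + 1), ((i.factorial : ℝ)⁻¹ • ((1 / 2 : ℝ) • Φ) ^ i) *ᵥ g

/-- The vector reached by Horner's rule for `taylorVec Φ k g` after `t` steps. -/
noncomputable def hornerVec (Φ : Matrix (Fin n) (Fin n) ℝ) (k : ℕ) (g : Fin n → ℝ) :
    ℕ → Fin n → ℝ
  | 0 => g
  | t + 1 => g + (1 / (2 * ((k - t : ℕ) : ℝ))) • Φ *ᵥ hornerVec Φ k g t

/-- A step raises each power of `Φ/2` by one and divides its coefficient by `k - t`, which turns
`(k-t)!/(k-t+i)!` into the ratio for `t + 1` and `i + 1`. At `t = k` the ratios are the Taylor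
coefficients `1/i!`. -/
theorem hornerVec_eq (Φ : Matrix (Fin n) (Fin n) ℝ) (k : ℕ) (g : Fin n → ℝ) (t : ℕ) (ht : t ≤ k) :
    hornerVec Φ k g t = ∑ i ∈ Finset.range (t + 1),
      ((((k - t).factorial : ℝ) / ((k - t + i).factorial : ℝ)) • ((1 / 2 : ℝ) • Φ) ^ i) *ᵥ g := by
  induction t with
  | zero =>
    have : ((k.factorial : ℝ)) ≠ 0 := by positivity
    simp [hornerVec, this]
  | succ t ih =>
    rw [hornerVec, ih (by omega), Finset.sum_range_succ' _ (t + 1), add_comm]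
    have h0 : (((k - (t + 1)).factorial : ℝ)) ≠ 0 := by positivity
    congr 1
    · rw [Matrix.mulVec_sum, Finset.smul_sum]
      refine Finset.sum_congr rfl fun i _ => ?_
      have hk : k - t = k - (t + 1) + 1 := by omega
      rw [Matrix.mulVec_mulVec, Matrix.mul_smul, ← Matrix.smul_mulVec, smul_smul, pow_succ' _ i,
        Matrix.smul_mul, smul_smul, hk, Nat.factorial_succ]
      congr 2
      have h1 : k - (t + 1) + 1 + i = k - (t + 1) + (i + 1) := by omega
      rw [h1]
      have h2 : (((k - (t + 1) + (i + 1)).factorial : ℝ)) ≠ 0 := by positivity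
      push_cast
      field_simp
    · simp [h0]

theorem hornerVec_self (Φ : Matrix (Fin n) (Fin n) ℝ) (k : ℕ) (g : Fin n → ℝ) :
    hornerVec Φ k g k = taylorVec Φ k g := by
  rw [hornerVec_eq Φ k g k le_rfl, taylorVec]
  simp

/-- This is why the program need not store the iterates outside the nonzero rows. -/
theorem hornerVec_apply_of_row_eq_zero (Φ : Matrix (Fin n) (Fin n) ℝ) (k : ℕ) (g : Fin n → ℝ)
    (t : ℕ) {i : Fin n} (hi : Φ i = 0) : hornerVec Φ k g t i = g i := by
  cases t with
  | zero => rfl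
  | succ t => simp [hornerVec, Matrix.mulVec, hi]

theorem PosSemidef.exists_orthogonal {Φ : Matrix (Fin n) (Fin n) ℝ} (hΦ : Φ.PosSemidef)
    {κ : ℝ} (hκ : ‖Matrix.toEuclideanCLM (𝕜 := ℝ) Φ‖ ≤ κ) :
    ∃ (U : Matrix (Fin n) (Fin n) ℝ) (d : Fin n → ℝ), U * Uᵀ = 1 ∧ Uᵀ * U = 1 ∧
      (∀ i, 0 ≤ d i ∧ d i ≤ κ) ∧ Φ = U * diagonal d * Uᵀ := by
  have hH := hΦ.1
  refine ⟨hH.eigenvectorUnitary, hH.eigenvalues, ?_, ?_, fun i => ⟨hΦ.eigenvalues_nonneg i, ?_⟩, ?_⟩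
  · exact (Matrix.mem_unitaryGroup_iff.1 hH.eigenvectorUnitary.2)
  · exact (Matrix.mem_unitaryGroup_iff'.1 hH.eigenvectorUnitary.2)
  · have h1 := (Matrix.toEuclideanCLM (𝕜 := ℝ) Φ).le_opNorm (hH.eigenvectorBasis i)
    have h2 : (Matrix.toEuclideanCLM (𝕜 := ℝ) Φ) (hH.eigenvectorBasis i) =
        hH.eigenvalues i • hH.eigenvectorBasis i := by
      ext j
      have := congrFun (hH.mulVec_eigenvectorBasis i) j
      simpa using this
    rw [h2, norm_smul] at h1
    simp only [OrthonormalBasis.norm_eq_one, mul_one] at h1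
    exact (le_abs_self _).trans (h1.trans hκ)
  · have h := hH.spectral_theorem
    rw [Unitary.conjStarAlgAut_apply] at h
    exact h

theorem exp_conj_diagonal {U : Matrix (Fin n) (Fin n) ℝ} (h1 : U * Uᵀ = 1) (d : Fin n → ℝ) :
    NormedSpace.exp (U * diagonal d * Uᵀ) = U * diagonal (fun i => Real.exp (d i)) * Uᵀ := by
  have hU : U⁻¹ = Uᵀ := Matrix.inv_eq_right_inv h1
  rw [← hU, Matrix.exp_conj _ _ (IsUnit.of_mul_eq_one _ h1), Matrix.exp_diagonal]
  congr 3
  funext i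
  rw [Pi.coe_exp, Real.exp_eq_exp_ℝ]

theorem conj_diagonal_pow {U : Matrix (Fin n) (Fin n) ℝ} (h2 : Uᵀ * U = 1) (d : Fin n → ℝ)
    (k : ℕ) (hU : U * Uᵀ = 1) : (U * diagonal d * Uᵀ) ^ k = U * diagonal (fun i => d i ^ k) * Uᵀ := by
  induction k with
  | zero => simp [hU]
  | succ k ih =>
    rw [pow_succ, ih]
    calc _ = U * diagonal (fun i => d i ^ k) * (Uᵀ * U) * diagonal d * Uᵀ := by
          simp only [Matrix.mul_assoc]
      _ = _ := by
          rw [h2, Matrix.mul_one, Matrix.mul_assoc U, Matrix.diagonal_mul_diagonal]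
          simp only [pow_succ]

theorem taylorVec_conj {U : Matrix (Fin n) (Fin n) ℝ} (h1 : U * Uᵀ = 1) (h2 : Uᵀ * U = 1)
    (d : Fin n → ℝ) (k : ℕ) (g : Fin n → ℝ) :
    taylorVec (U * diagonal d * Uᵀ) k g =
      (U * diagonal (fun i => taylorExp k (d i / 2)) * Uᵀ) *ᵥ g := by
  have hs : (1 / 2 : ℝ) • (U * diagonal d * Uᵀ) = U * diagonal (fun i => d i / 2) * Uᵀ := by
    rw [← Matrix.smul_mul, ← Matrix.mul_smul]
    congr 2
    ext i j
    by_cases h : i = j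
    · subst h; simp; ring
    · simp [h]
  rw [taylorVec, ← Matrix.sum_mulVec, hs]
  congr 1
  have : diagonal (fun i => taylorExp k (d i / 2)) =
      ∑ i ∈ Finset.range (k + 1), (i.factorial : ℝ)⁻¹ • diagonal (fun j => (d j / 2) ^ i) := by
    ext a b
    by_cases h : a = b
    · subst h
      simp [Matrix.sum_apply, taylorExp, div_eq_inv_mul]
    · simp [Matrix.sum_apply, h]
  rw [this, Matrix.mul_sum, Matrix.sum_mul]
  refine Finset.sum_congr rfl fun i _ => ?_
  rw [conj_diagonal_pow h2 _ _ h1, Matrix.mul_smul, Matrix.smul_mul]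

theorem dotProduct_conj_diagonal (U : Matrix (Fin n) (Fin n) ℝ) (d : Fin n → ℝ) (x : Fin n → ℝ) :
    x ⬝ᵥ (U * diagonal d * Uᵀ) *ᵥ x = ∑ i, d i * (Uᵀ *ᵥ x) i ^ 2 := by
  rw [← Matrix.mulVec_mulVec, ← Matrix.mulVec_mulVec, Matrix.dotProduct_mulVec,
    ← Matrix.mulVec_transpose]
  simp only [dotProduct, Matrix.mulVec_diagonal]
  exact Finset.sum_congr rfl fun i _ => by ring

/-- Rows of a symmetric Taylor polynomial: pairing with `g` and quality of the approximation. -/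
theorem exists_taylorVec_dual {Φ : Matrix (Fin n) (Fin n) ℝ} (hΦ : Φ.PosSemidef)
    {κ : ℝ} (hκ : ‖Matrix.toEuclideanCLM (𝕜 := ℝ) Φ‖ ≤ κ) {k : ℕ} (hk : 4 * κ ≤ k)
    (x : Fin n → ℝ) :
    ∃ w : Fin n → ℝ, (∀ g, x ⬝ᵥ taylorVec Φ k g = w ⬝ᵥ g) ∧
      (1 - (1 / 2) ^ k) ^ 2 * (x ⬝ᵥ NormedSpace.exp Φ *ᵥ x) ≤ w ⬝ᵥ w ∧
      w ⬝ᵥ w ≤ x ⬝ᵥ NormedSpace.exp Φ *ᵥ x := by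
  obtain ⟨U, d, h1, h2, hd, rfl⟩ := PosSemidef.exists_orthogonal hΦ hκ
  set t : Fin n → ℝ := fun i => taylorExp k (d i / 2) with ht
  have hsymm : (U * diagonal t * Uᵀ)ᵀ = U * diagonal t * Uᵀ := by
    simp [Matrix.transpose_mul, Matrix.mul_assoc]
  have hww : ((U * diagonal t * Uᵀ) *ᵥ x) ⬝ᵥ ((U * diagonal t * Uᵀ) *ᵥ x) =
      ∑ i, t i ^ 2 * (Uᵀ *ᵥ x) i ^ 2 := by
    rw [← dotProduct_conj_diagonal U (fun i => t i ^ 2) x, ← conj_diagonal_pow h2 t 2 h1]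
    generalize U * diagonal t * Uᵀ = B at hsymm
    rw [pow_two, ← Matrix.mulVec_mulVec, Matrix.dotProduct_mulVec x, ← Matrix.mulVec_transpose,
      hsymm]
  have hsq (y : ℝ) : Real.exp y = Real.exp (y / 2) ^ 2 := by
    rw [← Real.exp_nat_mul]; congr 1; push_cast; ring
  -- The witness is `P x` with `P` the Taylor polynomial at `Φ/2`. In the eigenbasis both estimates
  -- are termwise comparisons of `t i ^ 2` with `exp (d i) = exp (d i / 2) ^ 2`; hence the squared
  -- error factor, and `4κ ≤ k` is the condition `8 (d i / 2) ≤ k`.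
  refine ⟨(U * diagonal t * Uᵀ) *ᵥ x, fun g => ?_, ?_, ?_⟩
  · rw [taylorVec_conj h1 h2, Matrix.dotProduct_mulVec, ← Matrix.mulVec_transpose, hsymm]
  · rw [hww, exp_conj_diagonal h1, dotProduct_conj_diagonal, Finset.mul_sum]
    refine Finset.sum_le_sum fun i _ => ?_
    rw [← mul_assoc, hsq, ← mul_pow]
    have := exp_le_taylorExp (k := k) (x := d i / 2) (by linarith [hd i]) (by linarith [hd i])
    have h0 : (0 : ℝ) ≤ 1 - (1 / 2) ^ k := sub_nonneg.2 (pow_le_one₀ (by norm_num) (by norm_num))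
    gcongr
  · rw [hww, exp_conj_diagonal h1, dotProduct_conj_diagonal]
    refine Finset.sum_le_sum fun i _ => ?_
    rw [hsq]
    have h0 : 0 ≤ d i / 2 := by linarith [hd i]
    have := taylorExp_le_exp k h0
    have := taylorExp_nonneg k h0
    gcongr

theorem matDot_mul_transpose {r : ℕ} (M : Matrix (Fin n) (Fin n) ℝ) (Q : Matrix (Fin n) (Fin r) ℝ) :
    matDot M (Q * Qᵀ) = ∑ c, Qᵀ c ⬝ᵥ M *ᵥ Qᵀ c := by
  simp only [matDot, Matrix.mul_apply, dotProduct, Matrix.mulVec, Matrix.transpose_apply,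
    Finset.mul_sum]
  conv_rhs => rw [Finset.sum_comm]
  refine Finset.sum_congr rfl fun i _ => ?_
  rw [Finset.sum_comm]
  refine Finset.sum_congr rfl fun c _ => Finset.sum_congr rfl fun j _ => ?_
  ring

end WorkDepth

/-! ### Concentration of Gaussian sketches. -/

namespace WorkDepth
open MeasureTheory ProbabilityTheory

theorem hasLaw_sum_gaussian {n : ℕ} (w : Fin n → ℝ) :
    (Measure.infinitePi fun _ : Fin n => gaussianReal 0 1).map (fun y => ∑ j, w j * y j) =
      gaussianReal 0 (∑ j, w j ^ 2).toNNReal := by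
  have hind := iIndepFun_infinitePi (P := fun _ : Fin n => gaussianReal 0 1)
    (X := fun j y => w j * y) (fun j => by fun_prop)
  refine Measure.ext_of_charFun ?_
  rw [hind.charFun_map_fun_sum_eq_prod (fun j => Measurable.aemeasurable (by fun_prop))]
  ext t
  have hj (j : Fin n) : (Measure.infinitePi fun _ : Fin n => gaussianReal 0 1).map
      (fun y => w j * y j) = gaussianReal (w j * 0) (NNReal.mk (w j ^ 2) (sq_nonneg _) * 1) := by
    rw [← gaussianReal_map_const_mul]
    conv_rhs => rw [← Measure.infinitePi_map_eval (fun _ : Fin n => gaussianReal 0 1) j]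
    rw [Measure.map_map (by fun_prop) (by fun_prop)]
    rfl
  simp only [Finset.prod_apply, hj, charFun_gaussianReal]
  rw [← Complex.exp_sum]
  congr 1
  rw [Real.coe_toNNReal _ (Finset.sum_nonneg fun j _ => sq_nonneg _)]
  push_cast
  simp [Finset.sum_mul, Finset.sum_div]

/-- Multiplying the Gaussian density by `exp(s z²)` leaves a Gaussian integral with exponent
coefficient `1/2 - s`. -/
theorem mgf_sq_gaussian_aux {s : ℝ} (hs : s < 1 / 2) :
    Integrable (fun z : ℝ => Real.exp (s * z ^ 2)) (gaussianReal 0 1) ∧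
      ∫ z, Real.exp (s * z ^ 2) ∂gaussianReal 0 1 = (√(1 - 2 * s))⁻¹ := by
  have h1 : (fun z : ℝ => gaussianPDFReal 0 1 z * Real.exp (s * z ^ 2)) =
      fun z => (√(2 * Real.pi))⁻¹ * Real.exp (-(1 / 2 - s) * z ^ 2) := by
    funext z
    rw [gaussianPDFReal, mul_assoc, ← Real.exp_add]
    simp only [NNReal.coe_one, mul_one, sub_zero]
    congr 2
    ring
  constructor
  · rw [gaussianReal_of_var_ne_zero _ one_ne_zero,
      show gaussianPDF 0 1 = fun x => ENNReal.ofReal (gaussianPDFReal 0 1 x) from rfl,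
      integrable_withDensity_iff_integrable_smul₀' (by fun_prop) (by simp)]
    simp only [smul_eq_mul, ENNReal.toReal_ofReal (gaussianPDFReal_nonneg 0 1 _)]
    rw [h1]
    exact (integrable_exp_neg_mul_sq (by linarith)).const_mul _
  · rw [integral_gaussianReal_eq_integral_smul one_ne_zero]
    simp only [smul_eq_mul]
    rw [h1, integral_const_mul, integral_gaussian, ← Real.sqrt_inv, ← Real.sqrt_inv,
      ← Real.sqrt_mul (by positivity)]
    congr 1
    have : 1 - 2 * s ≠ 0 := by linarith
    have : (1 / 2 - s) ≠ 0 := by linarith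
    field_simp

/-- Write `1/(1-2s) = 1 + 2s/(1-2s) ≤ exp(2s/(1-2s))`. The remaining comparison of exponents reduces
to `4s²(1-4s) ≥ 0`, so it also covers the negative `s` needed for the lower tail. -/
theorem exp_neg_le_sqrt_inv {s : ℝ} (h2 : s ≤ 1 / 4) :
    (√(1 - 2 * s))⁻¹ ≤ Real.exp (s + 4 * s ^ 2) := by
  have hpos : 0 < 1 - 2 * s := by linarith
  rw [← Real.sqrt_inv, Real.sqrt_le_left (Real.exp_pos _).le, ← Real.exp_nat_mul]
  have hle : 2 * s / (1 - 2 * s) ≤ (2 : ℕ) * (s + 4 * s ^ 2) := by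
    rw [div_le_iff₀ hpos]
    push_cast
    nlinarith [mul_nonneg (sq_nonneg s) (sub_nonneg.2 h2)]
  refine le_trans ?_ (Real.exp_le_exp.2 hle)
  refine le_trans (le_of_eq ?_) (Real.add_one_le_exp _)
  field_simp
  ring

/-- Chernoff bounds for the sum of the squares of `m` independent centred Gaussians of
variance `v`. -/
theorem gaussian_sum_sq_tail {Ω : Type*} [MeasurableSpace Ω] {P : Measure Ω}
    [IsProbabilityMeasure P] {m : ℕ} {Z : Fin m → Ω → ℝ} (hZ : ∀ l, Measurable (Z l))
    {v : ℝ} (hv : 0 < v) (hlaw : ∀ l, P.map (Z l) = gaussianReal 0 v.toNNReal)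
    (hind : iIndepFun Z P) {δ : ℝ} (h0 : 0 ≤ δ) (h1 : δ ≤ 2) :
    P.real {x | m * ((1 + δ) * v) ≤ ∑ l, Z l x ^ 2} ≤ Real.exp (-(m * δ ^ 2 / 16)) ∧
    P.real {x | ∑ l, Z l x ^ 2 ≤ m * ((1 - δ) * v)} ≤ Real.exp (-(m * δ ^ 2 / 16)) := by
  have hvv : ((v.toNNReal : NNReal) : ℝ) = v := Real.coe_toNNReal _ hv.le
  have hstd : gaussianReal 0 v.toNNReal = (gaussianReal 0 1).map (√v * ·) := by
    rw [gaussianReal_map_const_mul]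
    congr 1
    · simp
    · ext; simp [hvv, Real.sq_sqrt hv.le]
  have hone (l : Fin m) {s : ℝ} (h2 : s ≤ 1 / 4) :
      Integrable (fun x => Real.exp (s / v * Z l x ^ 2)) P ∧
      mgf (fun x => Z l x ^ 2) P (s / v) ≤ Real.exp (s + 4 * s ^ 2) := by
    obtain ⟨hi, he⟩ := mgf_sq_gaussian_aux (s := s) (by linarith)
    have hcomp : (fun z : ℝ => Real.exp (s / v * z ^ 2)) ∘ (√v * ·) =
        fun z => Real.exp (s * z ^ 2) := by
      funext z
      simp only [Function.comp]
      rw [mul_pow, Real.sq_sqrt hv.le]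
      congr 1
      field_simp
    have hmeas : Measurable fun z : ℝ => Real.exp (s / v * z ^ 2) := by fun_prop
    constructor
    · have : Integrable (fun z : ℝ => Real.exp (s / v * z ^ 2)) (P.map (Z l)) := by
        rw [hlaw, hstd, integrable_map_measure hmeas.aestronglyMeasurable (by fun_prop), hcomp]
        exact hi
      exact this.comp_measurable (hZ l)
    · have h3 : mgf (fun x => Z l x ^ 2) P (s / v) = ∫ z, Real.exp (s * z ^ 2) ∂gaussianReal 0 1 := by
        rw [mgf, ← hcomp]
        have h4 := integral_map (μ := P) (hZ l).aemeasurable hmeas.aestronglyMeasurable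
        rw [← h4, hlaw, hstd, integral_map (by fun_prop) hmeas.aestronglyMeasurable]
        rfl
      rw [h3, he]
      exact exp_neg_le_sqrt_inv h2
  have hindsq : iIndepFun (fun l x => Z l x ^ 2) P :=
    hind.comp (fun _ z => z ^ 2) (fun _ => by fun_prop)
  have hall {s : ℝ} (h2 : s ≤ 1 / 4) :
      Integrable (fun x => Real.exp (s / v * (∑ l, fun x => Z l x ^ 2) x)) P ∧
      mgf (∑ l, fun x => Z l x ^ 2) P (s / v) ≤ Real.exp (m * (s + 4 * s ^ 2)) := by
    constructor
    · exact hindsq.integrable_exp_mul_sum (fun l => by fun_prop) (fun l _ => (hone l h2).1)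
    · rw [hindsq.mgf_sum (fun l => by fun_prop)]
      calc _ ≤ ∏ l : Fin m, Real.exp (s + 4 * s ^ 2) :=
            Finset.prod_le_prod (fun l _ => mgf_nonneg) fun l _ => (hone l h2).2
        _ = _ := by simp [← Real.exp_nat_mul]
  constructor
  -- The Chernoff exponent is `m(4s² - sδ)`, minimal at `s = δ/8` with value `-mδ²/16`; `δ ≤ 2`
  -- keeps `s ≤ 1/4`. The lower tail uses `-δ/8` in the same way.
  · obtain ⟨hi, hm⟩ := hall (s := δ / 8) (by linarith)
    have := measure_ge_le_exp_mul_mgf (m * ((1 + δ) * v)) (by positivity) hi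
    simp only [Finset.sum_apply] at this
    refine this.trans ((mul_le_mul_of_nonneg_left hm (Real.exp_pos _).le).trans ?_)
    rw [← Real.exp_add]
    refine Real.exp_le_exp.2 (le_of_eq ?_)
    field_simp
    ring
  · obtain ⟨hi, hm⟩ := hall (s := -(δ / 8)) (by linarith)
    have := measure_le_le_exp_mul_mgf (m * ((1 - δ) * v))
      (div_nonpos_of_nonpos_of_nonneg (by linarith) hv.le) hi
    simp only [Finset.sum_apply] at this
    refine this.trans ((mul_le_mul_of_nonneg_left hm (Real.exp_pos _).le).trans ?_)
    rw [← Real.exp_add]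
    refine Real.exp_le_exp.2 (le_of_eq ?_)
    field_simp
    ring

instance : IsProbabilityMeasure tapeLaw := by unfold tapeLaw; infer_instance

/-- The sketch vectors: consecutive blocks of the tape. -/
def tapeBlock (n : ℕ) (ω : ℕ → ℝ) (l : ℕ) : Fin n → ℝ := fun j => ω (l * n + j)

/-- The blocks read distinct cells: `(l, j) ↦ l * n + j` is injective for `j < n`. Independence of
the cells therefore gives independent blocks. -/
theorem tapeBlock_law (n m : ℕ) :
    tapeLaw.map (fun ω (l : Fin m) => tapeBlock n ω l) =
      Measure.infinitePi fun _ : Fin m => Measure.infinitePi fun _ : Fin n => gaussianReal 0 1 := by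
  rw [← Measure.infinitePi_map_curry (fun (_ : Fin m) (_ : Fin n) => gaussianReal 0 1)]
  have hinj : Function.Injective fun p : Fin m × Fin n => (p.1 : ℕ) * n + p.2 := by
    rintro ⟨l, j⟩ ⟨l', j'⟩ h
    simp only at h
    have hn : 0 < n := j.pos
    have h1 := congrArg (· / n) h
    have h2 := congrArg (· % n) h
    simp only [Nat.mul_add_mod_self_right, Nat.mod_eq_of_lt j.2, Nat.mod_eq_of_lt j'.2,
      Nat.add_div_of_dvd_right (Dvd.intro_left _ rfl), Nat.mul_div_cancel _ hn,
      Nat.div_eq_of_lt j.2, Nat.div_eq_of_lt j'.2, add_zero] at h1 h2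
    exact Prod.ext (Fin.ext h1) (Fin.ext h2)
  have h := Measure.map_infinitePi_infinitePi_of_inj (P := fun _ : ℕ => gaussianReal 0 1) hinj
  rw [← h, Measure.map_map (by fun_prop) (by fun_prop)]
  rfl

theorem tape_sketch_tail (n m : ℕ) (w : Fin n → ℝ) {δ : ℝ} (h0 : 0 < δ) (h1 : δ ≤ 2) :
    tapeLaw {ω | ¬ ((1 - δ) * (w ⬝ᵥ w) ≤ (∑ l : Fin m, (w ⬝ᵥ tapeBlock n ω l) ^ 2) / m ∧
      (∑ l : Fin m, (w ⬝ᵥ tapeBlock n ω l) ^ 2) / m ≤ (1 + δ) * (w ⬝ᵥ w))} ≤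
      ENNReal.ofReal (2 * Real.exp (-(m * δ ^ 2 / 16))) := by
  by_cases hw : w = 0
  · simp [hw]
  -- Without sketch vectors the claimed bound is `2`, which exceeds any probability.
  by_cases hm0 : m = 0
  · subst hm0
    refine prob_le_one.trans ?_
    simp
  have hm : (0 : ℝ) < m := by positivity
  have hv : w ⬝ᵥ w = ∑ j, w j ^ 2 := by simp [dotProduct, pow_two]
  have hpos : 0 < ∑ j, w j ^ 2 := by
    rw [← hv]
    exact lt_of_le_of_ne (by rw [hv]; positivity) (fun h => hw (dotProduct_self_eq_zero.1 h.symm))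
  set μ := Measure.infinitePi fun _ : Fin m => Measure.infinitePi fun _ : Fin n =>
    gaussianReal 0 1 with hμ
  have htail := gaussian_sum_sq_tail (P := μ) (Z := fun l y => ∑ j, w j * y l j) (fun l => by fun_prop)
    hpos (fun l => ?_) (iIndepFun_infinitePi
      (P := fun _ : Fin m => Measure.infinitePi fun _ : Fin n => gaussianReal 0 1)
      (X := fun _ y => ∑ j, w j * y j) (fun _ => by fun_prop)) h0.le h1
  · rw [← ofReal_measureReal]
    refine ENNReal.ofReal_le_ofReal ?_
    have hsub : {ω | ¬ ((1 - δ) * (w ⬝ᵥ w) ≤ (∑ l : Fin m, (w ⬝ᵥ tapeBlock n ω l) ^ 2) / m ∧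
        (∑ l : Fin m, (w ⬝ᵥ tapeBlock n ω l) ^ 2) / m ≤ (1 + δ) * (w ⬝ᵥ w))} ⊆
        (fun ω (l : Fin m) => tapeBlock n ω l) ⁻¹'
        ({y | m * ((1 + δ) * ∑ j, w j ^ 2) ≤ ∑ l, (∑ j, w j * y l j) ^ 2} ∪
        {y | ∑ l, (∑ j, w j * y l j) ^ 2 ≤ m * ((1 - δ) * ∑ j, w j ^ 2)}) := by
      intro ω h
      simp only [Set.mem_ofPred_eq, not_and_or, not_le] at h
      rw [hv] at h
      rcases h with h | h
      · right
        rw [div_lt_iff₀ hm] at h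
        exact (h.trans_eq (mul_comm _ _)).le
      · left
        rw [lt_div_iff₀ hm] at h
        exact ((mul_comm _ _).trans_lt h).le
    refine (measureReal_mono hsub).trans ?_
    have hmb : Measurable fun ω (l : Fin m) => tapeBlock n ω l := by unfold tapeBlock; fun_prop
    rw [← map_measureReal_apply hmb, tapeBlock_law]
    · refine (measureReal_union_le _ _).trans ?_
      linarith [htail.1, htail.2]
    · refine MeasurableSet.union (measurableSet_le (by fun_prop) (by fun_prop))
        (measurableSet_le (by fun_prop) (by fun_prop))
  · rw [← hasLaw_sum_gaussian, ← Measure.infinitePi_map_eval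
      (fun _ : Fin m => Measure.infinitePi fun _ : Fin n => gaussianReal 0 1) l,
      Measure.map_map (by fun_prop) (by fun_prop)]
    rfl

end WorkDepth

/-! ### The union bound over columns, and enumerations of sparse data. -/

namespace WorkDepth
open MeasureTheory Matrix

variable {n : ℕ}

/-- The estimate of `exp Φ • Q Qᵀ` from `m` sketch vectors and a Taylor polynomial of
degree `k`. -/
noncomputable def sketchDot (Φ : Matrix (Fin n) (Fin n) ℝ) {r : ℕ} (Q : Matrix (Fin n) (Fin r) ℝ)
    (k m : ℕ) (ω : ℕ → ℝ) : ℝ :=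
  (∑ c, ∑ l : Fin m, (Qᵀ c ⬝ᵥ taylorVec Φ k (tapeBlock n ω l)) ^ 2) / m

theorem exists_taylorVec_dual_zero (x : Fin n → ℝ) :
    ∃ w : Fin n → ℝ, (∀ g, x ⬝ᵥ taylorVec 0 0 g = w ⬝ᵥ g) ∧
      w ⬝ᵥ w = x ⬝ᵥ NormedSpace.exp (0 : Matrix (Fin n) (Fin n) ℝ) *ᵥ x :=
  ⟨x, fun g => by simp [taylorVec], by simp [NormedSpace.exp_zero]⟩

theorem card_filter_row_ne_zero_le {m n : ℕ} (M : Matrix (Fin m) (Fin n) ℝ)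
    [DecidablePred fun i => M i ≠ 0] : (Finset.univ.filter fun i => M i ≠ 0).card ≤ nnz M := by
  classical
  refine (Finset.card_le_card (t := (Finset.univ.filter
    fun ij : Fin m × Fin n => M ij.1 ij.2 ≠ 0).image Prod.fst) fun i hi => ?_).trans
    Finset.card_image_le
  obtain ⟨j, hj⟩ := Function.ne_iff.1 (Finset.mem_filter.1 hi).2
  exact Finset.mem_image.2 ⟨(i, j), by simpa using hj, rfl⟩

theorem nnz_eq_sum {m n : ℕ} (M : Matrix (Fin m) (Fin n) ℝ) :
    nnz M = ∑ i, (Finset.univ.filter fun j => M i j ≠ 0).card := by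
  simp only [nnz, Finset.card_filter, Fintype.sum_prod_type]

theorem nnz_transpose {m n : ℕ} (M : Matrix (Fin m) (Fin n) ℝ) : nnz Mᵀ = nnz M := by
  simp only [nnz_eq_sum, Finset.card_filter]
  exact Finset.sum_comm

/-- Each column is estimated with accuracy `ε/2`, and estimates for one matrix add up over its
columns. Zero columns are estimated exactly, so the union bound runs over the nonzero ones only;
their number is at most the number of nonzero entries. -/
theorem sketchDot_tail {Φ : Matrix (Fin n) (Fin n) ℝ} {r : Fin n → ℕ}
    (Q : (i : Fin n) → Matrix (Fin n) (Fin (r i)) ℝ) {k m q : ℕ} {ε : ℝ} (hε : 0 < ε)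
    (hε1 : ε ≤ 1 / 2)
    (hdual : ∀ x : Fin n → ℝ, ∃ w : Fin n → ℝ, (∀ g, x ⬝ᵥ taylorVec Φ k g = w ⬝ᵥ g) ∧
      (1 - ε / 2) * (x ⬝ᵥ NormedSpace.exp Φ *ᵥ x) ≤ w ⬝ᵥ w ∧
      w ⬝ᵥ w ≤ x ⬝ᵥ NormedSpace.exp Φ *ᵥ x)
    (hq : ∑ i, nnz (Q i) ≤ q) :
    tapeLaw {ω | ¬ ∀ i : Fin n,
        (1 - ε) * matDot (NormedSpace.exp Φ) (Q i * (Q i)ᵀ) ≤ sketchDot Φ (Q i) k m ω ∧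
        sketchDot Φ (Q i) k m ω ≤ (1 + ε) * matDot (NormedSpace.exp Φ) (Q i * (Q i)ᵀ)} ≤
      ENNReal.ofReal (q * (2 * Real.exp (-(m * ε ^ 2 / 64)))) := by
  classical
  choose w hw hlo hhi using hdual
  set bad : (Σ i, Fin (r i)) → Set (ℕ → ℝ) := fun p =>
    {ω | ¬ ((1 - ε / 2) * (w ((Q p.1)ᵀ p.2) ⬝ᵥ w ((Q p.1)ᵀ p.2)) ≤
        (∑ l : Fin m, (w ((Q p.1)ᵀ p.2) ⬝ᵥ tapeBlock n ω l) ^ 2) / m ∧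
      (∑ l : Fin m, (w ((Q p.1)ᵀ p.2) ⬝ᵥ tapeBlock n ω l) ^ 2) / m ≤
        (1 + ε / 2) * (w ((Q p.1)ᵀ p.2) ⬝ᵥ w ((Q p.1)ᵀ p.2)))} with hbad
  set S : Finset (Σ i, Fin (r i)) :=
    Finset.univ.sigma fun i => Finset.univ.filter fun c => (Q i)ᵀ c ≠ 0 with hS
  have hcard : S.card ≤ q := by
    rw [hS, Finset.card_sigma]
    refine (Finset.sum_le_sum fun i _ => ?_).trans hq
    rw [← nnz_transpose]
    exact card_filter_row_ne_zero_le _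
  have hsub : {ω | ¬ ∀ i : Fin n,
        (1 - ε) * matDot (NormedSpace.exp Φ) (Q i * (Q i)ᵀ) ≤ sketchDot Φ (Q i) k m ω ∧
        sketchDot Φ (Q i) k m ω ≤ (1 + ε) * matDot (NormedSpace.exp Φ) (Q i * (Q i)ᵀ)} ⊆
      ⋃ p ∈ S, bad p := by
    intro ω hω
    by_contra hcon
    refine hω fun i => ?_
    have hgood (c : Fin (r i)) :
        (1 - ε) * ((Q i)ᵀ c ⬝ᵥ NormedSpace.exp Φ *ᵥ (Q i)ᵀ c) ≤
          (∑ l : Fin m, ((Q i)ᵀ c ⬝ᵥ taylorVec Φ k (tapeBlock n ω l)) ^ 2) / m ∧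
        (∑ l : Fin m, ((Q i)ᵀ c ⬝ᵥ taylorVec Φ k (tapeBlock n ω l)) ^ 2) / m ≤
          (1 + ε) * ((Q i)ᵀ c ⬝ᵥ NormedSpace.exp Φ *ᵥ (Q i)ᵀ c) := by
      by_cases hc : (Q i)ᵀ c = 0
      · simp [hc]
      have h1 : ω ∉ bad ⟨i, c⟩ := fun h => hcon (Set.mem_biUnion (by simpa [hS] using hc) h)
      simp only [hbad, Set.mem_ofPred_eq, not_not] at h1
      simp only [hw]
      have h0 : 0 ≤ w ((Q i)ᵀ c) ⬝ᵥ w ((Q i)ᵀ c) := Finset.sum_nonneg fun j _ => mul_self_nonneg _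
      have hl := hlo ((Q i)ᵀ c)
      have hh := hhi ((Q i)ᵀ c)
      -- The Taylor and sketching errors combine through `(1 - ε/2)² ≥ 1 - ε`; above, the Taylor
      -- polynomial never overshoots and `1 + ε/2 ≤ 1 + ε`.
      refine ⟨le_trans ?_ h1.1, h1.2.trans ?_⟩
      · nlinarith [mul_le_mul_of_nonneg_left hl (show (0 : ℝ) ≤ 1 - ε / 2 by linarith),
          mul_nonneg (sq_nonneg ε) (h0.trans hh)]
      · nlinarith [mul_nonneg hε.le (h0.trans hh)]
    rw [matDot_mul_transpose, sketchDot, Finset.sum_div, Finset.mul_sum, Finset.mul_sum]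
    exact ⟨Finset.sum_le_sum fun c _ => (hgood c).1, Finset.sum_le_sum fun c _ => (hgood c).2⟩
  have hone : ∀ p ∈ S, tapeLaw (bad p) ≤ ENNReal.ofReal (2 * Real.exp (-(m * ε ^ 2 / 64))) := by
    intro p _
    refine (tape_sketch_tail n m _ (by linarith) (by linarith)).trans (le_of_eq ?_)
    congr 4
    ring
  calc _ ≤ tapeLaw (⋃ p ∈ S, bad p) := measure_mono hsub
    _ ≤ ∑ p ∈ S, tapeLaw (bad p) := measure_biUnion_finset_le _ _
    _ ≤ ∑ p ∈ S, ENNReal.ofReal (2 * Real.exp (-(m * ε ^ 2 / 64))) := Finset.sum_le_sum hone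
    _ = ENNReal.ofReal (S.card * (2 * Real.exp (-(m * ε ^ 2 / 64)))) := by
      rw [Finset.sum_const, nsmul_eq_mul, ENNReal.ofReal_mul (p := (S.card : ℝ)) (Nat.cast_nonneg _),
        ENNReal.ofReal_natCast]
    _ ≤ _ := ENNReal.ofReal_le_ofReal (by gcongr)

/-- The entries of a list that satisfy a predicate, as an increasing enumeration. -/
theorem exists_filter_enum {m : ℕ} (P : Fin m → Prop) [DecidablePred P] :
    ∃ idx : Fin (Finset.univ.filter P).card → Fin m, StrictMono idx ∧
      (∀ i, P i ↔ ∃ e, idx e = i) ∧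
      ∀ g : Fin m → Val, Val.ofList (((List.finRange m).filter fun i => P i).map g) =
        .arr (Finset.univ.filter P).card fun e => g (idx e) := by
  set l := (List.finRange m).filter fun i => P i with hl
  have hnd : l.Nodup := (List.nodup_finRange m).filter _
  have hmem (i : Fin m) : i ∈ l ↔ P i := by simp [hl]
  have hcard : (Finset.univ.filter P).card = l.length := by
    rw [← List.toFinset_card_of_nodup hnd]
    congr 1
    ext i
    simp [hmem]
  have hsort : l.Pairwise (· < ·) := (List.pairwise_lt_finRange m).filter _
  rw [hcard]
  refine ⟨l.get, fun a b hab => List.pairwise_iff_get.1 hsort a b hab, fun i => ?_, fun g => ?_⟩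
  · rw [← hmem]
    exact List.mem_iff_get
  · have key : ∀ (l' : List Val) (N : ℕ) (f : Fin N → Val) (h : l'.length = N),
        (∀ e : Fin l'.length, l'.get e = f ⟨e, h ▸ e.2⟩) → Val.ofList l' = .arr N f := by
      rintro l' _ f rfl h
      rw [Val.ofList]
      congr 1
      exact funext h
    exact key _ _ _ (by simp) (fun e => by simp)

theorem sum_enum {m s : ℕ} {P : Fin m → Prop} {idx : Fin s → Fin m} (hidx : StrictMono idx)
    (hP : ∀ i, P i ↔ ∃ e, idx e = i) {F : Fin m → ℝ} (hF : ∀ i, ¬ P i → F i = 0) :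
    ∑ e, F (idx e) = ∑ i, F i := by
  classical
  rw [← Finset.sum_image (s := Finset.univ) (g := idx) (f := F) hidx.injective.injOn]
  refine Finset.sum_subset (Finset.subset_univ _) fun i _ hi => hF i fun h => hi ?_
  obtain ⟨e, he⟩ := (hP i).1 h
  exact Finset.mem_image.2 ⟨e, Finset.mem_univ _, he⟩

end WorkDepth

/-! ### Programs for sparse dot products and for positions of rows. -/

namespace WorkDepth
open Matrix

/-- The number of nonzero entries of a vector. -/
noncomputable def vecNnz {n : ℕ} (x : Fin n → ℝ) : ℕ := (Finset.univ.filter fun j => x j ≠ 0).card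

theorem vecNnz_le {n : ℕ} (x : Fin n → ℝ) : vecNnz x ≤ n :=
  (Finset.card_le_univ _).trans_eq (Fintype.card_fin n)

theorem exists_sparseVec_eq {n : ℕ} (x : Fin n → ℝ) :
    ∃ idx : Fin (vecNnz x) → Fin n, StrictMono idx ∧ (∀ j, x j ≠ 0 ↔ ∃ e, idx e = j) ∧
      sparseVec x = .arr (vecNnz x) fun e => .pair (.nat (idx e : ℕ)) (.real (x (idx e))) := by
  obtain ⟨idx, h1, h2, h3⟩ := exists_filter_enum fun j => x j ≠ 0
  exact ⟨idx, h1, h2, h3 _⟩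

noncomputable instance decidableRowNeZero {m n : ℕ} (M : Matrix (Fin m) (Fin n) ℝ) :
    DecidablePred fun i : Fin m => M i ≠ 0 :=
  fun _ => inferInstance

/-- The number of nonzero rows of a matrix. -/
noncomputable def rowCount {m n : ℕ} (M : Matrix (Fin m) (Fin n) ℝ) : ℕ :=
  (Finset.univ.filter fun i => M i ≠ 0).card

theorem rowCount_le {m n : ℕ} (M : Matrix (Fin m) (Fin n) ℝ) : rowCount M ≤ m :=
  (Finset.card_le_univ _).trans_eq (Fintype.card_fin m)

theorem rowCount_le_nnz {m n : ℕ} (M : Matrix (Fin m) (Fin n) ℝ) : rowCount M ≤ nnz M :=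
  card_filter_row_ne_zero_le M

theorem exists_sparseRows_eq {m n : ℕ} (M : Matrix (Fin m) (Fin n) ℝ) :
    ∃ idx : Fin (rowCount M) → Fin m, StrictMono idx ∧ (∀ i, M i ≠ 0 ↔ ∃ e, idx e = i) ∧
      sparseRows M =
        .arr (rowCount M) fun e => .pair (.nat (idx e : ℕ)) (sparseVec (M (idx e))) := by
  obtain ⟨idx, h1, h2, h3⟩ := exists_filter_enum fun i => M i ≠ 0
  exact ⟨idx, h1, h2, h3 _⟩

theorem nnz_eq_sum_enum {m n : ℕ} (M : Matrix (Fin m) (Fin n) ℝ) {s : ℕ} {idx : Fin s → Fin m}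
    (hidx : StrictMono idx) (hM : ∀ i, M i ≠ 0 ↔ ∃ e, idx e = i) :
    ∑ e, vecNnz (M (idx e)) = nnz M := by
  have h := sum_enum hidx hM (F := fun i => (vecNnz (M i) : ℝ)) fun i hi => by
    simp [vecNnz, not_not.1 hi]
  rw [nnz_eq_sum]
  exact_mod_cast h

theorem eq_zero_of_rowCount_eq_zero {m n : ℕ} {M : Matrix (Fin m) (Fin n) ℝ}
    (h : rowCount M = 0) : M = 0 := by
  funext i
  by_contra hi
  exact Finset.filter_eq_empty_iff.1 (Finset.card_eq_zero.1 h) (Finset.mem_univ i) hi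

/-- The dot product of the sparse vector in variable `i` with a vector whose entries are computed
by `look` from the index in variable `0`. -/
def sparseDotE (i : ℕ) (look : Expr) : Expr :=
  .letE (.tab (.len (.var i))
    (.realOp .mul (.snd (.get (.var (i + 1)) (.var 0)))
      (.letE (.fst (.get (.var (i + 1)) (.var 0))) look))) treeSum

/-- The lookup has to succeed only where `x` is nonzero. This is what permits the other vector to be
stored on a subset of the indices. -/
theorem Runs.sparseDotE {ω : ℕ → ℝ} {σ : List Val} {i n W D : ℕ} {look : Expr} {x u : Fin n → ℝ}
    (hx : σ[i]? = some (sparseVec x))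
    (hl : ∀ (e : ℕ) (j : Fin n), x j ≠ 0 →
      Runs ω look (.nat (j : ℕ) :: .nat e :: σ) (.real (u j)) W D) :
    Runs ω (sparseDotE i look) σ (.real (x ⬝ᵥ u)) (vecNnz x * (W + 120) + 30)
      (D + 50 * Nat.clog 2 n + 40) := by
  obtain ⟨idx, h1, h2, h3⟩ := exists_sparseVec_eq x
  have hi : (σ[i]? = some (.arr (vecNnz x) fun e => .pair (.nat (idx e : ℕ)) (.real (x (idx e))))) :=
    hx.trans (congrArg some h3)
  have hclog := Nat.clog_mono_right 2 (vecNnz_le x)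
  refine (Runs.letE (Runs.tab_const (W' := W + 10) (D' := D + 10)
    (f := fun e => .real (x (idx e) * u (idx e))) (.len (.var hi)) fun e => ?_)
    (Runs.treeSum _)).conv ?_ ?_ ?_
  · have hget : Runs ω (.get (.var (i + 1)) (.var 0)) (.nat (e : ℕ) :: σ)
        (.pair (.nat (idx e : ℕ)) (.real (x (idx e)))) 3 3 :=
      (Runs.get (.var (by simpa using hi)) (.var rfl) e.2).conv rfl le_rfl le_rfl
    exact (Runs.realOp (.snd hget) (.letE (.fst hget)
      (hl e (idx e) ((h2 _).2 ⟨e, rfl⟩)))).conv rfl (by omega) (by omega)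
  · rw [sum_enum h1 h2 (F := fun j => x j * u j) fun j hj => by simp [not_not.1 hj]]
    rfl
  · ring_nf
    omega
  · omega

/-- The body of a binary search for the number in variable `0` among the indices of the rows in
variable `4`; the result is the position, or the number of rows if there is none. -/
def positionE : Expr :=
  .letE (.fst (.letE (.pair (.lit 0) (.len (.var 4)))
    (.whileE (.natOp .lt (.fst (.var 0)) (.snd (.var 0)))
      (.letE (.natOp .div (.natOp .add (.fst (.var 0)) (.snd (.var 0))) (.lit 2))
        (.ite (.natOp .lt (.fst (.get (.var 6) (.var 0))) (.var 2))
          (.pair (.natOp .add (.var 0) (.lit 1)) (.snd (.var 1)))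
          (.pair (.fst (.var 1)) (.var 0)))))))
    (.ite (.natOp .lt (.var 0) (.len (.var 5)))
      (.ite (.natOp .lt (.fst (.get (.var 5) (.var 0))) (.natOp .add (.var 1) (.lit 1)))
        (.var 0) (.len (.var 5)))
      (.len (.var 5)))

/-- The invariant is that entries before `lo` are below `i` and entries from `hi` on are at least
`i`. An interval of length `N` shrinks to length at most `N / 2`, and `clog 2 (N + 1)` exceeds `clog
2 (N / 2 + 1)` by one. -/
theorem Runs.binarySearch {ω : ℕ → ℝ} {s i : ℕ} {idx : Fin s → ℕ} (hidx : StrictMono idx)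
    {V : Fin s → Val} {σ : List Val}
    (hR : σ[3]? = some (.arr s fun e => .pair (.nat (idx e)) (V e))) (N lo hi : ℕ)
    (hN : hi = lo + N) (hs : hi ≤ s) (hlo : ∀ e : Fin s, (e : ℕ) < lo → idx e < i)
    (hhi : ∀ e : Fin s, hi ≤ (e : ℕ) → i ≤ idx e) :
    ∃ q ≤ s, (∀ e : Fin s, (e : ℕ) < q → idx e < i) ∧ (∀ e : Fin s, q ≤ (e : ℕ) → i ≤ idx e) ∧
      Runs ω (.whileE (.natOp .lt (.fst (.var 0)) (.snd (.var 0)))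
      (.letE (.natOp .div (.natOp .add (.fst (.var 0)) (.snd (.var 0))) (.lit 2))
        (.ite (.natOp .lt (.fst (.get (.var 6) (.var 0))) (.var 2))
          (.pair (.natOp .add (.var 0) (.lit 1)) (.snd (.var 1)))
          (.pair (.fst (.var 1)) (.var 0)))))
        (.pair (.nat lo) (.nat hi) :: .nat i :: σ) (.pair (.nat q) (.nat q))
        (40 * Nat.clog 2 (N + 1) + 10) (40 * Nat.clog 2 (N + 1) + 10) := by
  induction N using Nat.strong_induction_on generalizing lo hi with
  | _ N ih =>
    have hc : Runs ω (.natOp .lt (.fst (.var 0)) (.snd (.var 0)))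
        (.pair (.nat lo) (.nat hi) :: .nat i :: σ) (.nat (if lo < hi then 1 else 0)) 5 5 :=
      (Runs.natOp (.fst (.var rfl)) (.snd (.var rfl))).conv rfl (by omega) (by omega)
    rcases Nat.eq_zero_or_pos N with rfl | hpos
    · obtain rfl : hi = lo := by omega
      rw [if_neg (by omega)] at hc
      exact ⟨hi, hs, hlo, hhi, (Runs.while_done hc).mono (by omega) (by omega)⟩
    · rw [if_pos (by omega)] at hc
      have hmid : (lo + hi) / 2 < s := by omega
      have hclog : Nat.clog 2 (N + 1) = Nat.clog 2 (N / 2 + 1) + 1 := by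
        rw [Nat.clog_of_two_le one_lt_two (by omega)]
        congr 2
        omega
      have hm : Runs ω (.natOp .div (.natOp .add (.fst (.var 0)) (.snd (.var 0))) (.lit 2))
          (.pair (.nat lo) (.nat hi) :: .nat i :: σ) (.nat ((lo + hi) / 2)) 7 7 :=
        (Runs.natOp (.natOp (.fst (.var rfl)) (.snd (.var rfl))) .lit).conv rfl
          (by omega) (by omega)
      have hg : Runs ω (.get (.var 6) (.var 0))
          (.nat ((lo + hi) / 2) :: .pair (.nat lo) (.nat hi) :: .nat i :: σ)
          (.pair (.nat (idx ⟨(lo + hi) / 2, hmid⟩)) (V ⟨(lo + hi) / 2, hmid⟩)) 3 3 :=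
        Runs.get_of_eq (.var (by exact hR)) (.var rfl) hmid rfl
      have ht : Runs ω (.natOp .lt (.fst (.get (.var 6) (.var 0))) (.var 2))
          (.nat ((lo + hi) / 2) :: .pair (.nat lo) (.nat hi) :: .nat i :: σ)
          (.nat (if idx ⟨(lo + hi) / 2, hmid⟩ < i then 1 else 0)) 6 6 :=
        Runs.conv (Runs.natOp (.fst hg) (.var rfl)) rfl
          (by omega) (by omega)
      by_cases hlt : idx ⟨(lo + hi) / 2, hmid⟩ < i
      · rw [if_pos hlt] at ht
        obtain ⟨q, hq, h1, h2, h3⟩ := ih (hi - ((lo + hi) / 2 + 1)) (by omega) ((lo + hi) / 2 + 1) hi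
          (by omega) hs (fun e he => (hidx.monotone (show e ≤ ⟨(lo + hi) / 2, hmid⟩ from by
            rw [Fin.le_def]; simp only; omega)).trans_lt hlt) hhi
        have hle := Nat.clog_mono_right 2 (show hi - ((lo + hi) / 2 + 1) + 1 ≤ N / 2 + 1 by omega)
        refine ⟨q, hq, h1, h2, (Runs.while_step hc one_ne_zero (Runs.letE hm
          (Runs.ite (W' := 6) (D' := 6) ht (fun _ => ?_) (fun h => absurd h one_ne_zero))) h3).mono
          ?_ ?_⟩
        exacts [(Runs.pair (.natOp (.var rfl) .lit) (.snd (.var rfl))).conv rfl (W' := 6) (D' := 6)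
          (by omega) (by omega), by omega, by omega]
      · rw [if_neg hlt] at ht
        obtain ⟨q, hq, h1, h2, h3⟩ := ih ((lo + hi) / 2 - lo) (by omega) lo ((lo + hi) / 2)
          (by omega) (by omega) hlo (fun e he => (not_lt.1 hlt).trans (hidx.monotone
            (show ⟨(lo + hi) / 2, hmid⟩ ≤ e from by rw [Fin.le_def]; exact he)))
        have hle := Nat.clog_mono_right 2 (show (lo + hi) / 2 - lo + 1 ≤ N / 2 + 1 by omega)
        refine ⟨q, hq, h1, h2, (Runs.while_step hc one_ne_zero (Runs.letE hm
          (Runs.ite (W' := 6) (D' := 6) ht (fun h => absurd rfl h) (fun _ => ?_))) h3).mono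
          (by omega) (by omega)⟩
        exact (Runs.pair (.fst (.var rfl)) (.var rfl)).conv rfl (by omega) (by omega)

theorem Runs.positionE {ω : ℕ → ℝ} {s : ℕ} (i : ℕ) {idx : Fin s → ℕ} (hidx : StrictMono idx)
    {V : Fin s → Val} {σ : List Val}
    (hR : σ[3]? = some (.arr s fun e => .pair (.nat (idx e)) (V e))) :
    ∃ q : ℕ, ((∃ e : Fin s, idx e = i ∧ q = (e : ℕ)) ∨ (q = s ∧ ∀ e, idx e ≠ i)) ∧
      Runs ω positionE (.nat i :: σ) (.nat q)
        (40 * Nat.clog 2 (s + 1) + 50) (40 * Nat.clog 2 (s + 1) + 50) := by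
  obtain ⟨q, hq, h1, h2, h3⟩ := Runs.binarySearch (ω := ω) (i := i) hidx hR s 0 s (by omega) le_rfl
    (fun e he => absurd he (by omega)) (fun e he => absurd e.2 (by omega))
  have hfst := Runs.fst (Runs.letE (W := 4) (D := 4)
    ((Runs.pair .lit (.len (.var (i := 4) (σ := .nat i :: σ) hR))).mono (by omega) (by omega)) h3)
  have hc : Runs ω (.natOp .lt (.var 0) (.len (.var 5))) (.nat q :: .nat i :: σ)
      (.nat (if q < s then 1 else 0)) 4 4 :=
    Runs.conv (Runs.natOp (.var rfl) (.len (.var (by exact hR)))) rfl (by omega) (by omega)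
  have hlen : Runs ω (.len (.var 5)) (.nat q :: .nat i :: σ) (.nat s) 2 2 :=
    Runs.mono (Runs.len (.var (by exact hR))) (by omega) (by omega)
  by_cases hqs : q < s
  · have hg : Runs ω (.get (.var 5) (.var 0)) (.nat q :: .nat i :: σ)
        (.pair (.nat (idx ⟨q, hqs⟩)) (V ⟨q, hqs⟩)) 3 3 :=
      Runs.get_of_eq (.var (by exact hR)) (.var rfl) hqs rfl
    have hd : Runs ω (.natOp .lt (.fst (.get (.var 5) (.var 0))) (.natOp .add (.var 1) (.lit 1)))
        (.nat q :: .nat i :: σ) (.nat (if idx ⟨q, hqs⟩ < i + 1 then 1 else 0)) 8 8 :=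
      Runs.conv (Runs.natOp (.fst hg) (.natOp (.var rfl) .lit)) rfl
        (by omega) (by omega)
    -- Naturals can be compared only by `lt`; given this lower bound, the test `idx q < i + 1`
    -- decides equality with `i`.
    have hge := h2 ⟨q, hqs⟩ le_rfl
    by_cases heq : idx ⟨q, hqs⟩ < i + 1
    · refine ⟨q, Or.inl ⟨⟨q, hqs⟩, by omega, rfl⟩, ?_⟩
      rw [if_pos heq] at hd
      rw [if_pos hqs] at hc
      exact (Runs.letE hfst (Runs.ite hc (fun _ => Runs.ite (W' := 2) (D' := 2) hd
        (fun _ => (Runs.var rfl).mono (by omega) (by omega)) (fun h => absurd h one_ne_zero))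
        (fun h => absurd h one_ne_zero))).mono (by omega) (by omega)
    · refine ⟨s, Or.inr ⟨rfl, fun e he => ?_⟩, ?_⟩
      · rcases lt_or_ge (e : ℕ) q with h | h
        · have := h1 e h
          omega
        · have := hidx.monotone (show (⟨q, hqs⟩ : Fin s) ≤ e from by rw [Fin.le_def]; exact h)
          omega
      rw [if_neg heq] at hd
      rw [if_pos hqs] at hc
      exact (Runs.letE hfst (Runs.ite hc (fun _ => Runs.ite (W' := 2) (D' := 2) hd
        (fun h => absurd rfl h) (fun _ => hlen))
        (fun h => absurd h one_ne_zero))).mono (by omega) (by omega)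
  · refine ⟨s, Or.inr ⟨rfl, fun e he => ?_⟩, ?_⟩
    · have := h1 e (by omega)
      omega
    rw [if_neg hqs] at hc
    exact (Runs.letE hfst (Runs.ite hc (fun h => absurd rfl h) (fun _ => hlen))).mono
      (by omega) (by omega)

end WorkDepth

/-! ### Horner's rule on the nonzero rows, and the estimates. -/

namespace WorkDepth
open Matrix

/-- One step of Horner's rule for a sketch vector, restricted to the nonzero rows. -/
def hornerStepE : Expr :=
  .pair (.natOp .sub (.fst (.var 0)) (.lit 1))
    (.tab (.len (.var 10))
      (.letE (.get (.var 11) (.var 0))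
        (.letE (.snd (.var 0))
          (.realOp .add (.gauss (.natOp .add (.natOp .mul (.var 4) (.var 10)) (.fst (.var 1))))
            (.realOp .div (sparseDotE 0 (.get (.snd (.var 5)) (.get (.var 11) (.var 0))))
              (.cast (.natOp .mul (.lit 2) (.fst (.var 3)))))))))

/-- The Taylor polynomial applied to a Gaussian sketch vector. The environment holds the number of
the sketch vector, the number of sketch vectors, the degree, two unused values, the table of
positions, the dimension, two unused values, and the matrix. -/
def sketchE : Expr :=
  .letE (.letE (.pair (.var 2) (.tab (.len (.var 9))
      (.gauss (.natOp .add (.natOp .mul (.var 1) (.var 7)) (.fst (.get (.var 10) (.var 0)))))))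
    (.whileE (.fst (.var 0)) hornerStepE))
  (.tab (.var 7) (.letE (.get (.var 7) (.var 0))
    (.ite (.natOp .lt (.var 0) (.len (.var 12)))
      (.get (.snd (.var 2)) (.var 0))
      (.gauss (.natOp .add (.natOp .mul (.var 3) (.var 9)) (.var 1))))))

/-- `f` lists the positions of the numbers `i` in the enumeration `idx`, and `s` where there is
none. -/
def IsPositionTable {n s : ℕ} (idx : Fin s → Fin n) (f : Fin n → ℕ) : Prop :=
  ∀ i, (∃ e, idx e = i ∧ f i = (e : ℕ)) ∨ (f i = s ∧ ∀ e, idx e ≠ i)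

section

variable {ω : ℕ → ℝ} {n k l m : ℕ} {Φ : Matrix (Fin n) (Fin n) ℝ} {vL vT vε vκ : Val}
  {τ : List Val} {f : Fin n → ℕ} {idx : Fin (rowCount Φ) → Fin n}

/-- The overhead per row is paid by its nonzero entries, as there are at most `nnz Φ` nonzero rows.
All rows run in parallel, so the depth is that of one sparse dot product. -/
theorem Runs.hornerStepE (hΦ : Φᵀ = Φ) (hidx : StrictMono idx)
    (hmem : ∀ i, Φ i ≠ 0 ↔ ∃ e, idx e = i)
    (hrows : sparseRows Φ = .arr (rowCount Φ) fun e =>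
      .pair (.nat (idx e : ℕ)) (sparseVec (Φ (idx e))))
    (hf : IsPositionTable idx f) (j : ℕ) (x : Fin n → ℝ) :
    Runs ω hornerStepE (.pair (.nat j) (.arr (rowCount Φ) fun e => .real (x (idx e))) ::
        .nat l :: .nat m :: .nat k :: vL :: vT :: .arr n (fun i => .nat (f i)) :: .nat n :: vε ::
        vκ :: sparseRows Φ :: τ)
      (.pair (.nat (j - 1)) (.arr (rowCount Φ) fun e =>
        .real ((tapeBlock n ω l + (1 / (2 * (j : ℝ))) • Φ *ᵥ x) (idx e))))
      (200 * nnz Φ + 20) (50 * Nat.clog 2 n + 100) := by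
  have hsum := nnz_eq_sum_enum Φ hidx hmem
  refine Runs.mono (Runs.pair ((Runs.natOp (.fst (.var rfl)) .lit).conv rfl le_rfl le_rfl)
    (Runs.tab (N := rowCount Φ) (W := 2) (D := 2) (W' := fun e => vecNnz (Φ (idx e)) * 126 + 70)
      (D' := 50 * Nat.clog 2 n + 70)
      ?_ fun r => ?_)) ?_ (by omega)
  · rw [hrows]
    exact (Runs.len (.var rfl)).mono (by omega) (by omega)
  · have hrow : Runs ω (.get (.var 11) (.var 0)) (.nat (r : ℕ) ::
        .pair (.nat j) (.arr (rowCount Φ) fun e => .real (x (idx e))) ::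
        .nat l :: .nat m :: .nat k :: vL :: vT :: .arr n (fun i => .nat (f i)) :: .nat n :: vε ::
        vκ :: sparseRows Φ :: τ) (.pair (.nat (idx r : ℕ)) (sparseVec (Φ (idx r)))) 3 3 := by
      rw [hrows]
      exact Runs.get_of_eq (.var rfl) (.var rfl) r.2 rfl
    refine Runs.mono (Runs.letE hrow (Runs.letE (.snd (.var rfl)) (Runs.conv
      (Runs.realOp (.gauss (.natOp (.natOp (.var rfl) (.var rfl)) (.fst (.var rfl))))
      (.realOp (Runs.sparseDotE (x := Φ (idx r)) (u := x) (W := 6) (D := 6) rfl fun e j' hj => ?_)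
        (.cast (.natOp .lit (.fst (.var rfl)))))) (W' := vecNnz (Φ (idx r)) * 126 + 50)
        (D' := 50 * Nat.clog 2 n + 60) ?_ ?_ ?_))) ?_ ?_
    -- A nonzero entry in column `j'` makes row `j'` nonzero by symmetry, so the stored iterate has
    -- a value there.
    · have hj' : Φ j' ≠ 0 := fun h => hj (by
        rw [← hΦ, Matrix.transpose_apply, h]
        rfl)
      rcases hf j' with ⟨e', he, hfe⟩ | ⟨-, hno⟩
      · refine Runs.conv (Runs.get_of_eq (i := f j') (v := .real (x j')) (.snd (.var rfl))
          (Runs.get_of_eq (.var rfl) (.var rfl) j'.2 rfl) (by omega) ?_) rfl (by omega) (by omega)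
        exact congrArg (fun i => Val.real (x i)) ((congrArg idx (Fin.ext hfe)).trans he)
      · obtain ⟨e', he⟩ := (hmem j').1 hj'
        exact absurd he (hno e')
    · simp only [RealOp.den, NatOp.den, tapeBlock, Pi.add_apply, Pi.smul_apply, smul_eq_mul,
        Matrix.mulVec]
      congr 2
      push_cast
      ring
    all_goals omega
  · rw [Finset.sum_add_distrib, ← Finset.sum_mul, hsum]
    have := rowCount_le_nnz Φ
    simp only [Finset.sum_const, Finset.card_univ, Fintype.card_fin, smul_eq_mul]
    omega

/-- The loop counter runs down from `k`, so in step `t` it is the divisor `k - t` of Horner's rule.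
Only the final expansion to all `n` coordinates costs `O(n)`, once per sketch vector; coordinates of
zero rows are read off the tape. -/
theorem Runs.sketchE (hΦ : Φᵀ = Φ) (hidx : StrictMono idx)
    (hmem : ∀ i, Φ i ≠ 0 ↔ ∃ e, idx e = i)
    (hrows : sparseRows Φ = .arr (rowCount Φ) fun e =>
      .pair (.nat (idx e : ℕ)) (sparseVec (Φ (idx e))))
    (hf : IsPositionTable idx f) :
    Runs ω sketchE (.nat l :: .nat m :: .nat k :: vL :: vT :: .arr n (fun i => .nat (f i)) ::
        .nat n :: vε :: vκ :: sparseRows Φ :: τ)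
      (.arr n fun i => .real (taylorVec Φ k (tapeBlock n ω l) i))
      (k * (200 * nnz Φ + 30) + 50 * n + 50) (k * (50 * Nat.clog 2 n + 110) + 50) := by
  have hcount := rowCount_le Φ
  have hloop := Runs.while_iterate (ω := ω) (c := .fst (.var 0)) (body := WorkDepth.hornerStepE)
    (σ := .nat l :: .nat m :: .nat k :: vL :: vT :: .arr n (fun i => .nat (f i)) ::
        .nat n :: vε :: vκ :: sparseRows Φ :: τ)
    (fun t => .pair (.nat (k - t)) (.arr (rowCount Φ) fun e =>
      .real (hornerVec Φ k (tapeBlock n ω l) t (idx e)))) k (W := 2) (D := 2)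
    (fun t ht => ⟨k - t, by omega, (Runs.fst (.var rfl)).mono (by omega) (by omega)⟩)
    ((Runs.fst (.var rfl)).conv (by simp) (by omega) (by omega))
    (fun t _ => (Runs.hornerStepE hΦ hidx hmem hrows hf (k - t) _).conv rfl le_rfl le_rfl)
  rw [hornerVec_self] at hloop
  have hinit : Runs ω (.pair (.var 2) (.tab (.len (.var 9))
      (.gauss (.natOp .add (.natOp .mul (.var 1) (.var 7)) (.fst (.get (.var 10) (.var 0)))))))
      (.nat l :: .nat m :: .nat k :: vL :: vT :: .arr n (fun i => .nat (f i)) ::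
        .nat n :: vε :: vκ :: sparseRows Φ :: τ)
      (.pair (.nat (k - 0)) (.arr (rowCount Φ) fun e =>
        .real (hornerVec Φ k (tapeBlock n ω l) 0 (idx e)))) (10 * n + 10) 20 := by
    rw [hrows]
    refine Runs.mono (Runs.pair (.var rfl) (Runs.tab_const (.len (.var rfl)) fun r => Runs.conv
      (Runs.gauss (.natOp (.natOp (.var rfl) (.var rfl)) (Runs.fst (v := sparseVec (Φ (idx r)))
        (Runs.get_of_eq (.var rfl) (.var rfl) r.2 rfl)))) (W' := 10) (D' := 10) rfl ?_ ?_)) ?_ ?_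
    all_goals omega
  refine Runs.mono (Runs.letE (Runs.letE hinit hloop) (Runs.tab_const (W' := 20) (D' := 20)
    (.var rfl) fun i => ?_)) ?_ ?_
  · have hget : Runs ω (.get (.var 7) (.var 0)) (.nat (i : ℕ) :: .pair (.nat (k - k))
        (.arr (rowCount Φ) fun e => .real (taylorVec Φ k (tapeBlock n ω l) (idx e))) :: .nat l ::
        .nat m :: .nat k :: vL :: vT :: .arr n (fun i => .nat (f i)) ::
        .nat n :: vε :: vκ :: sparseRows Φ :: τ) (.nat (f i)) 3 3 :=
      Runs.get_of_eq (.var rfl) (.var rfl) i.2 rfl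
    rw [hrows] at hget ⊢
    refine Runs.mono (Runs.letE hget (Runs.ite (W' := 8) (D' := 8)
      (Runs.natOp (.var rfl) (.len (.var rfl))) (fun h => ?_) (fun h => ?_)))
      (by omega) (by omega)
    · rcases hf i with ⟨e, he, hfe⟩ | ⟨hfi, -⟩
      · refine Runs.conv (Runs.get_of_eq (i := f i)
          (v := .real (taylorVec Φ k (tapeBlock n ω l) i)) (.snd (.var rfl)) (.var rfl)
          (by omega) ?_) rfl (by omega) (by omega)
        exact congrArg (fun i => Val.real (taylorVec Φ k (tapeBlock n ω l) i))
          ((congrArg idx (Fin.ext hfe)).trans he)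
      · simp [NatOp.den, hfi] at h
    · rcases hf i with ⟨e, he, hfe⟩ | ⟨hfi, hno⟩
      · simp [NatOp.den, hfe] at h
      · have hi : Φ i = 0 := by
          by_contra hi
          obtain ⟨e, he⟩ := (hmem i).1 hi
          exact hno e he
        rw [← hornerVec_self, hornerVec_apply_of_row_eq_zero _ _ _ _ hi]
        exact Runs.conv (Runs.gauss (.natOp (.natOp (.var rfl) (.var rfl)) (.var rfl))) rfl
          (by omega) (by omega)
  · ring_nf
    omega
  · ring_nf
    omega

end

/-- The estimate for one column in variable `0`, among those of the matrix in variable `1`: the sum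
over the sketch vectors of the squares of the dot products. -/
def columnE : Expr :=
  .letE (.snd (.get (.var 1) (.var 0)))
    (.letE (.tab (.var 5)
      (.letE (.get (.var 5) (.var 0))
        (.letE (sparseDotE 2 (.get (.var 2) (.var 0))) (.realOp .mul (.var 0) (.var 0))))) treeSum)

/-- The estimate for the matrix whose number is in variable `0`. -/
def estimateE : Expr :=
  .letE (.get (.var 11) (.var 0))
    (.realOp .div (.letE (.tab (.len (.var 0)) columnE) treeSum) (.cast (.var 3)))

theorem Runs.columnE {ω : ℕ → ℝ} {n r m t i : ℕ} {u : ℕ → Fin n → ℝ} {τ : List Val}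
    {idx : Fin t → Fin r} {M : Matrix (Fin r) (Fin n) ℝ} (c : Fin t) :
    Runs ω columnE (.nat (c : ℕ) ::
        .arr t (fun e => .pair (.nat (idx e : ℕ)) (sparseVec (M (idx e)))) :: .nat i ::
        .arr m (fun l => .arr n fun j => .real (u l j)) :: .nat m :: τ)
      (.real (∑ l : Fin m, (M (idx c) ⬝ᵥ u l) ^ 2))
      (m * (150 * vecNnz (M (idx c)) + 150) + 50)
      (50 * Nat.clog 2 n + 50 * Nat.clog 2 m + 100) := by
  have hcol : Runs ω (.get (.var 1) (.var 0)) (.nat (c : ℕ) ::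
        .arr t (fun e => .pair (.nat (idx e : ℕ)) (sparseVec (M (idx e)))) :: .nat i ::
        .arr m (fun l => .arr n fun j => .real (u l j)) :: .nat m :: τ)
      (.pair (.nat (idx c : ℕ)) (sparseVec (M (idx c)))) 3 3 :=
    Runs.get_of_eq (.var rfl) (.var rfl) c.2 rfl
  refine Runs.mono (Runs.letE (.snd hcol) (Runs.letE (Runs.tab_const (.var rfl) fun l =>
    Runs.letE (Runs.get_of_eq (v := .arr n fun j => .real (u l j)) (.var rfl) (.var rfl) l.2 rfl)
    (Runs.letE (Runs.sparseDotE (x := M (idx c)) (u := u l) (W := 3) (D := 3) rfl fun e j _ => ?_)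
      (Runs.conv (Runs.realOp (.var rfl) (.var rfl))
        (v' := .real ((M (idx c) ⬝ᵥ u l) ^ 2)) ?_ le_rfl le_rfl))) (Runs.treeSum _))) ?_ ?_
  · exact Runs.get_of_eq (.var rfl) (.var rfl) j.2 rfl
  · simp [RealOp.den, pow_two]
  · ring_nf
    nlinarith [Nat.zero_le (m * vecNnz (M (idx c)))]
  · omega

theorem Runs.estimateE {ω : ℕ → ℝ} {n m : ℕ} {r : Fin n → ℕ}
    {Q : (i : Fin n) → Matrix (Fin n) (Fin (r i)) ℝ} {u : ℕ → Fin n → ℝ}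
    {vk vL vT vpos vn vε vκ vR : Val} {τ : List Val} (i : Fin n) (hm : 1 ≤ m) :
    Runs ω estimateE (.nat (i : ℕ) :: .arr m (fun l => .arr n fun j => .real (u l j)) :: .nat m ::
        vk :: vL :: vT :: vpos :: vn :: vε :: vκ :: vR ::
        .arr n (fun i => sparseRows (Q i)ᵀ) :: τ)
      (.real ((∑ c, ∑ l : Fin m, ((Q i)ᵀ c ⬝ᵥ u l) ^ 2) / m))
      (m * (500 * nnz (Q i)) + 50)
      (50 * Nat.clog 2 n + 50 * Nat.clog 2 m + 50 * Nat.clog 2 (nnz (Q i)) + 200) := by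
  obtain ⟨idx, hidx, hmem, hrows⟩ := exists_sparseRows_eq (Q i)ᵀ
  have hsum := nnz_eq_sum_enum (Q i)ᵀ hidx hmem
  have hcount := rowCount_le_nnz (Q i)ᵀ
  rw [nnz_transpose] at hsum hcount
  have hclog := Nat.clog_mono_right 2 hcount
  have hget : Runs ω (.get (.var 11) (.var 0)) (.nat (i : ℕ) ::
      .arr m (fun l => .arr n fun j => .real (u l j)) :: .nat m ::
        vk :: vL :: vT :: vpos :: vn :: vε :: vκ :: vR ::
        .arr n (fun i => sparseRows (Q i)ᵀ) :: τ) (sparseRows (Q i)ᵀ) 3 3 :=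
    Runs.get_of_eq (.var rfl) (.var rfl) i.2 rfl
  rw [hrows] at hget
  refine Runs.conv (Runs.letE hget (Runs.realOp (Runs.letE (Runs.tab (.len (.var rfl))
    fun c => Runs.columnE (M := (Q i)ᵀ) (idx := idx) c) (Runs.treeSum _)) (.cast (.var rfl))))
    ?_ ?_ ?_
  · rw [sum_enum hidx hmem (F := fun c => ∑ l : Fin m, ((Q i)ᵀ c ⬝ᵥ u l) ^ 2)
      fun c hc => by simp [not_not.1 hc]]
    rfl
  · rw [Finset.sum_add_distrib, ← Finset.mul_sum, Finset.sum_add_distrib, ← Finset.mul_sum, hsum]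
    simp only [Finset.sum_const, Finset.card_univ, Fintype.card_fin, smul_eq_mul]
    have h1 : m * (150 * nnz (Q i) + rowCount (Q i)ᵀ * 150) ≤ m * (300 * nnz (Q i)) :=
      Nat.mul_le_mul_left _ (by omega)
    -- The final summation over columns costs `O(nnz (Q i))` without a factor `m`; `1 ≤ m` absorbs
    -- it.
    have h2 : 1 * nnz (Q i) ≤ m * nnz (Q i) := Nat.mul_le_mul_right _ hm
    have h3 : m * (300 * nnz (Q i)) = 300 * (m * nnz (Q i)) := by ring
    have h4 : m * (500 * nnz (Q i)) = 500 * (m * nnz (Q i)) := by ring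
    omega
  · omega

end WorkDepth

/-! ### The whole program and its cost. -/

namespace WorkDepth
open Matrix

/-- The algorithm, with `c * log n / ε ^ 2` sketch vectors up to constant factors. -/
def bigDotExpE (c : ℕ) : Expr :=
  .letE (.tab (.var 0) positionE)
  (.letE (.letE (.realOp .div (.cast (.lit 1)) (.var 2)) powTwoCeil)
  (.letE (.letE (.cast (.var 2)) powTwoCeil)
  (.letE (.ite (.len (.var 6))
    (.natOp .mul (.lit 4) (.natOp .mul (.snd (.letE (.var 5) powTwoCeil)) (.fst (.var 1))))
    (.lit 0))
  (.letE (.natOp .mul (.lit c) (.natOp .mul (.fst (.var 1))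
    (.natOp .mul (.snd (.var 2)) (.snd (.var 2)))))
  (.letE (.tab (.var 0) sketchE)
  (.tab (.var 6) estimateE))))))

/-- The degree of the Taylor polynomial that the algorithm uses. -/
noncomputable def degree {n : ℕ} (ε κ : ℝ) (Φ : Matrix (Fin n) (Fin n) ℝ) : ℕ :=
  if rowCount Φ = 0 then 0 else 4 * (2 ^ clogReal κ * clogReal (1 / ε))

/-- The number of sketch vectors that the algorithm uses. -/
noncomputable def sketchCount (c n : ℕ) (ε : ℝ) : ℕ :=
  c * (clogReal n * (2 ^ clogReal (1 / ε) * 2 ^ clogReal (1 / ε)))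

theorem Runs.bigDotExpE {ω : ℕ → ℝ} {n c : ℕ} {ε κ : ℝ} {Φ : Matrix (Fin n) (Fin n) ℝ}
    {r : Fin n → ℕ} {Q : (i : Fin n) → Matrix (Fin n) (Fin (r i)) ℝ} (hΦ : Φᵀ = Φ)
    (hm : 1 ≤ sketchCount c n ε) :
    Runs ω (bigDotExpE c) (dotExpInput ε κ Φ Q)
      (.arr n fun i => .real (sketchDot Φ (Q i) (degree ε κ Φ) (sketchCount c n ε) ω))
      (n * (40 * Nat.clog 2 (n + 1) + 100) + 20 * clogReal (1 / ε) + 20 * clogReal n +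
        20 * (clogReal κ * nnz Φ) +
        sketchCount c n ε * (degree ε κ Φ * (200 * nnz Φ + 30) + 50 * n + 50) +
        500 * (sketchCount c n ε * ∑ i, nnz (Q i)) + 300)
      (40 * Nat.clog 2 (n + 1) + 20 * clogReal (1 / ε) + 20 * clogReal n + 20 * clogReal κ +
        degree ε κ Φ * (50 * Nat.clog 2 n + 110) + 50 * Nat.clog 2 n +
        50 * Nat.clog 2 (sketchCount c n ε) + 50 * Nat.clog 2 (∑ i, nnz (Q i)) + 600) := by
  obtain ⟨idx, hidx, hmem, hrows⟩ := exists_sparseRows_eq Φ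
  have hclog := Nat.clog_mono_right 2 (Nat.add_le_add_right (rowCount_le Φ) 1)
  have hpos (i : Fin n) := Runs.positionE (ω := ω) (i : ℕ) (idx := fun e => (idx e : ℕ))
    (fun a b h => hidx h) (V := fun e => sparseVec (Φ (idx e))) (σ := dotExpInput ε κ Φ Q)
    (congrArg some hrows)
  choose f hf hrun using hpos
  have hf' : IsPositionTable idx f := fun i => by
    rcases hf i with ⟨e, he, h⟩ | ⟨h, hno⟩
    · exact Or.inl ⟨e, Fin.ext he, h⟩
    · exact Or.inr ⟨h, fun e he => hno e (congrArg Fin.val he)⟩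
  refine Runs.mono (Runs.letE (Runs.tab_const (f := fun i => .nat (f i))
    (W' := 40 * Nat.clog 2 (n + 1) + 50) (D' := 40 * Nat.clog 2 (n + 1) + 50) (.var rfl)
    fun i => (hrun i).mono (by omega) (by omega))
    (Runs.letE (Runs.letE (.realOp (.cast .lit) (.var rfl)) (Runs.powTwoCeil _))
    (Runs.letE (Runs.letE (.cast (.var rfl)) (Runs.powTwoCeil _))
    (Runs.letE (u := .nat (degree ε κ Φ)) (W := 20 * (clogReal κ * nnz Φ) + 40)
      (D := 20 * clogReal κ + 40) ?_
    (Runs.letE (u := .nat (sketchCount c n ε)) (W := 12) (D := 12) ?_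
    (Runs.letE (Runs.tab_const (.var rfl) fun l =>
      Runs.sketchE (l := l) (k := degree ε κ Φ) hΦ hidx hmem hrows hf')
    (Runs.tab (D' := 50 * Nat.clog 2 n + 50 * Nat.clog 2 (sketchCount c n ε) +
        50 * Nat.clog 2 (∑ i, nnz (Q i)) + 200) (.var rfl)
      fun i => Runs.mono (Runs.estimateE (Q := Q)
        (u := fun l => taylorVec Φ (degree ε κ Φ) (tapeBlock n ω l)) i hm) le_rfl ?_))))))) ?_ ?_
  · unfold dotExpInput
    rw [hrows]
    refine Runs.mono (Runs.ite (W' := 20 * (clogReal κ * nnz Φ) + 30) (D' := 20 * clogReal κ + 30)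
      (.len (.var rfl)) (fun h => ?_) (fun h => ?_)) (by omega) (by omega)
    -- The power of two above `κ` is searched for only when `Φ ≠ 0`, so this cost can be charged to
    -- `nnz Φ`. For `Φ = 0` the allowed work does not depend on `κ`.
    · have hp : 1 ≤ nnz Φ := (Nat.one_le_iff_ne_zero.2 h).trans (rowCount_le_nnz Φ)
      have hle := Nat.mul_le_mul_left (clogReal κ) hp
      refine Runs.conv (Runs.natOp .lit (.natOp (.snd (.letE (.var rfl) (Runs.powTwoCeil κ)))
        (.fst (.var rfl)))) ?_ (by omega) (by omega)
      simp only [NatOp.den, degree, if_neg h, RealOp.den, Nat.cast_one]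
    · exact Runs.lit.conv (by rw [degree, if_pos h]) (by omega) (by omega)
  · refine Runs.conv (Runs.natOp .lit (.natOp (.fst (.var rfl))
      (.natOp (.snd (.var rfl)) (.snd (.var rfl))))) ?_ (by omega) (by omega)
    simp only [NatOp.den, sketchCount, RealOp.den, Nat.cast_one]
  · have := Nat.clog_mono_right 2 (Finset.single_le_sum (f := fun i => nnz (Q i))
      (fun _ _ => Nat.zero_le _) (Finset.mem_univ i))
    omega
  · rw [Finset.sum_add_distrib, ← Finset.mul_sum, ← Finset.mul_sum]
    simp only [Finset.sum_const, Finset.card_univ, Fintype.card_fin, smul_eq_mul, RealOp.den,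
      Nat.cast_one]
    ring_nf
    omega
  · simp only [RealOp.den, Nat.cast_one]
    omega

theorem clogReal_natCast (n : ℕ) : clogReal n = Nat.clog 2 n := by
  rw [clogReal, Nat.ceil_natCast]

theorem two_pow_clogReal_le {y : ℝ} (hy : 1 ≤ y) : (2 : ℝ) ^ clogReal y ≤ 2 * y := by
  rcases Nat.eq_zero_or_pos (clogReal y) with h | h
  · rw [h]
    linarith
  · have := two_pow_lt_of_lt_clogReal (Nat.sub_lt h one_pos)
    calc (2 : ℝ) ^ clogReal y = 2 * 2 ^ (clogReal y - 1) := by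
          rw [← pow_succ']
          congr 1
          omega
      _ ≤ 2 * y := by linarith

/-- Rounding up costs at most one, and `2 ≤ y` makes the logarithm at least one. -/
theorem clogReal_le_two_mul_logb {y : ℝ} (hy : 2 ≤ y) : (clogReal y : ℝ) ≤ 2 * Real.logb 2 y := by
  have h1 : (1 : ℝ) ≤ Real.logb 2 y := by
    rw [Real.le_logb_iff_rpow_le one_lt_two (by linarith)]
    simpa using hy
  have h2 : (clogReal y : ℝ) ≤ Real.logb 2 (2 * y) := by
    rw [Real.le_logb_iff_rpow_le one_lt_two (by linarith), Real.rpow_natCast]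
    exact two_pow_clogReal_le (by linarith)
  rw [Real.logb_mul (by norm_num) (by linarith), Real.logb_self_eq_one one_lt_two] at h2
  linarith

theorem logb_le_clogReal {y : ℝ} (hy : 0 < y) : Real.logb 2 y ≤ clogReal y := by
  rw [Real.logb_le_iff_le_rpow one_lt_two hy, Real.rpow_natCast]
  exact le_two_pow_clogReal y

theorem one_le_clogReal {y : ℝ} (hy : 2 ≤ y) : 1 ≤ clogReal y := by
  rw [Nat.one_le_iff_ne_zero]
  intro h
  have := le_two_pow_clogReal y
  rw [h] at this
  linarith

end WorkDepth

/-! ### Comparison with the claimed bounds on depth, work and failure. -/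

namespace WorkDepth
open Matrix

section Bounds

variable {n : ℕ} {ε κ : ℝ} {Φ : Matrix (Fin n) (Fin n) ℝ}

theorem two_le_inv_of_le_half (hε : 0 < ε) (hε1 : ε ≤ 1 / 2) : 2 ≤ 1 / ε := by
  rw [le_div_iff₀ hε]
  linarith

theorem one_le_logb_two {y : ℝ} (hy : 2 ≤ y) : 1 ≤ Real.logb 2 y := by
  rw [Real.le_logb_iff_rpow_le one_lt_two (by linarith)]
  simpa using hy

theorem degree_le (hε : 0 < ε) (hε1 : ε ≤ 1 / 2) (hκ : 1 ≤ κ) :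
    (degree ε κ Φ : ℝ) ≤ 16 * (κ * Real.logb 2 (1 / ε)) := by
  have ht := one_le_logb_two (two_le_inv_of_le_half hε hε1)
  rw [degree]
  split_ifs
  · push_cast
    positivity
  · push_cast
    calc (4 : ℝ) * (2 ^ clogReal κ * clogReal (1 / ε)) ≤
        4 * ((2 * κ) * (2 * Real.logb 2 (1 / ε))) := by
          gcongr
          · exact two_pow_clogReal_le hκ
          · exact clogReal_le_two_mul_logb (two_le_inv_of_le_half hε hε1)
      _ = _ := by ring

theorem clogReal_le_two_mul (hκ : 1 ≤ κ) : (clogReal κ : ℝ) ≤ 2 * κ :=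
  le_trans (by exact_mod_cast (Nat.lt_two_pow_self (n := clogReal κ)).le) (two_pow_clogReal_le hκ)

theorem sketchCount_le (hn : 2 ≤ n) (hε : 0 < ε) (hε1 : ε ≤ 1 / 2) (c : ℕ) :
    (sketchCount c n ε : ℝ) ≤ 8 * c * (1 / ε ^ 2 * Real.logb 2 n) := by
  have hn' : (2 : ℝ) ≤ n := by exact_mod_cast hn
  have h2 := two_le_inv_of_le_half hε hε1
  have hT := two_pow_clogReal_le (y := 1 / ε) (by linarith)
  rw [sketchCount]
  push_cast
  calc (c : ℝ) * (clogReal n * (2 ^ clogReal (1 / ε) * 2 ^ clogReal (1 / ε))) ≤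
      c * ((2 * Real.logb 2 n) * ((2 * (1 / ε)) * (2 * (1 / ε)))) := by
        gcongr
        · linarith [one_le_logb_two hn']
        · exact clogReal_le_two_mul_logb hn'
    _ = _ := by
        field_simp
        ring

theorem le_sketchCount (hn : 2 ≤ n) (hε : 0 < ε) (c : ℕ) :
    c * (Real.logb 2 n * (1 / ε ^ 2)) ≤ sketchCount c n ε := by
  have hn' : (0 : ℝ) < n := by exact_mod_cast (by omega : 0 < n)
  rw [sketchCount]
  push_cast
  have h : (1 / ε ^ 2 : ℝ) = (1 / ε) * (1 / ε) := by field_simp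
  rw [h]
  have hT := le_two_pow_clogReal (1 / ε)
  gcongr
  exact logb_le_clogReal hn'

theorem one_le_sketchCount (hn : 2 ≤ n) {c : ℕ} (hc : 1 ≤ c) : 1 ≤ sketchCount c n ε := by
  have h := one_le_clogReal (y := n) (by exact_mod_cast hn)
  exact Nat.one_le_iff_ne_zero.2 (by simp only [sketchCount]; positivity)

/-- Bounding the factors `c` and `clogReal n` crudely by powers of two is harmless: the depth may
contain a full `log n`. -/
theorem clog_sketchCount_le (c : ℕ) :
    Nat.clog 2 (sketchCount c n ε) ≤ c + clogReal n + 2 * clogReal (1 / ε) := by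
  refine Nat.clog_le_of_le_pow ?_
  rw [sketchCount, pow_add, pow_add, mul_assoc, two_mul, pow_add]
  gcongr
  · exact Nat.lt_two_pow_self.le
  · exact Nat.lt_two_pow_self.le

/-- The factors `κ`, `log n` and `log(1/ε)` are all at least one, so their product dominates each
term. The assumption `q ≤ n^a` bounds the depth of the sums over columns by `O(a log n)`. -/
theorem depth_bound (a c : ℕ) (hn : 2 ≤ n) (hε : 0 < ε) (hε1 : ε ≤ 1 / 2) (hκ : 1 ≤ κ) {q : ℕ}
    (hq : q ≤ n ^ a) :
    ((40 * Nat.clog 2 (n + 1) + 20 * clogReal (1 / ε) + 20 * clogReal n + 20 * clogReal κ +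
        degree ε κ Φ * (50 * Nat.clog 2 n + 110) + 50 * Nat.clog 2 n +
        50 * Nat.clog 2 (sketchCount c n ε) + 50 * Nat.clog 2 q + 600 : ℕ) : ℝ) ≤
      (100 * a + 50 * c + 10000) * (κ * Real.logb 2 n * Real.logb 2 (1 / ε)) := by
  have hn' : (2 : ℝ) ≤ n := by exact_mod_cast hn
  have h2 := two_le_inv_of_le_half hε hε1
  have ht := one_le_logb_two h2
  have hl := one_le_logb_two hn'
  have hT := clogReal_le_two_mul_logb h2
  have hL := clogReal_le_two_mul_logb hn'
  have hK := clogReal_le_two_mul hκ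
  have hk := degree_le (Φ := Φ) hε hε1 hκ
  set t := Real.logb 2 (1 / ε)
  set l := Real.logb 2 (n : ℝ)
  set T := clogReal (1 / ε)
  set L := clogReal (n : ℝ) with hLdef
  have hLn : Nat.clog 2 n = L := (clogReal_natCast n).symm
  have h1 : Nat.clog 2 (n + 1) ≤ L + 1 := by
    refine Nat.clog_le_of_le_pow ?_
    have := Nat.le_pow_clog one_lt_two n
    rw [hLn] at this
    rw [pow_succ]
    omega
  have hm := clog_sketchCount_le (n := n) (ε := ε) c
  have hqa : Nat.clog 2 q ≤ a * L := by
    refine Nat.clog_le_of_le_pow (hq.trans ?_)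
    rw [mul_comm, pow_mul]
    gcongr
    rw [← hLn]
    exact Nat.le_pow_clog one_lt_two n
  have hnat : 40 * Nat.clog 2 (n + 1) + 20 * T + 20 * L + 20 * clogReal κ +
        degree ε κ Φ * (50 * Nat.clog 2 n + 110) + 50 * Nat.clog 2 n +
        50 * Nat.clog 2 (sketchCount c n ε) + 50 * Nat.clog 2 q + 600 ≤
      160 * L + 120 * T + 20 * clogReal κ + degree ε κ Φ * (50 * L + 110) + 50 * c +
        50 * (a * L) + 640 := by
    rw [hLn]
    omega
  have hX1 : 1 ≤ κ * l := one_le_mul_of_one_le_of_one_le hκ hl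
  have hX : 1 ≤ κ * l * t := one_le_mul_of_one_le_of_one_le hX1 ht
  have hlX : l ≤ κ * l * t := by
    calc l = 1 * l * 1 := by ring
      _ ≤ κ * l * t := by gcongr
  have htX : t ≤ κ * l * t := le_mul_of_one_le_left (by linarith) hX1
  have hκX : κ ≤ κ * l * t := by
    calc κ = κ * 1 * 1 := by ring
      _ ≤ κ * l * t := by gcongr
  have hkX : (degree ε κ Φ : ℝ) * (50 * L + 110) ≤ 16 * (κ * t) * (210 * l) := by
    gcongr
    linarith
  have haX : (a : ℝ) * L ≤ a * (2 * (κ * l * t)) := by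
    gcongr
    linarith
  have hcX : (c : ℝ) ≤ c * (κ * l * t) := le_mul_of_one_le_right (by positivity) hX
  have hr := (Nat.cast_le (α := ℝ)).2 hnat
  push_cast at hr ⊢
  linarith

/-- The assumption on `n` absorbs the position table, of cost `n log n`, and the `m n` work of
expanding the sketch vectors. -/
theorem work_bound (c : ℕ) (hn : 2 ≤ n) (hε : 0 < ε) (hε1 : ε ≤ 1 / 2) (hκ : 1 ≤ κ) {q : ℕ}
    (hq : n ≤ nnz Φ + q) :
    ((n * (40 * Nat.clog 2 (n + 1) + 100) + 20 * clogReal (1 / ε) + 20 * clogReal n +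
        20 * (clogReal κ * nnz Φ) +
        sketchCount c n ε * (degree ε κ Φ * (200 * nnz Φ + 30) + 50 * n + 50) +
        500 * (sketchCount c n ε * q) + 300 : ℕ) : ℝ) ≤
      (50000 * c + 10000) * (1 / ε ^ 2 * (κ * Real.logb 2 (1 / ε) * nnz Φ + q) * Real.logb 2 n) := by
  have hn' : (2 : ℝ) ≤ n := by exact_mod_cast hn
  have h2 := two_le_inv_of_le_half hε hε1
  have ht := one_le_logb_two h2
  have hl := one_le_logb_two hn'
  -- If `Φ = 0`, the work bound has no factor `log(1/ε)`; here `clogReal (1 / ε)` is charged to `1/ε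
  -- ≤ 1/ε²` instead.
  have hT := (show (clogReal (1 / ε) : ℝ) ≤ 2 ^ clogReal (1 / ε) by
    exact_mod_cast (Nat.lt_two_pow_self (n := clogReal (1 / ε))).le).trans
    (two_pow_clogReal_le (y := 1 / ε) (by linarith))
  have hL := clogReal_le_two_mul_logb hn'
  have hK := clogReal_le_two_mul hκ
  have hk := degree_le (Φ := Φ) hε hε1 hκ
  have hm := sketchCount_le hn hε hε1 c
  -- The constant overhead of a Horner step is charged to `nnz Φ`; this works because the degree is
  -- zero when `Φ = 0`.
  have hkp : degree ε κ Φ * (200 * nnz Φ + 30) ≤ 230 * (degree ε κ Φ * nnz Φ) := by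
    rw [degree]
    split_ifs with h
    · simp
    · have hp : 1 ≤ nnz Φ := (Nat.one_le_iff_ne_zero.2 h).trans (rowCount_le_nnz Φ)
      calc _ ≤ 4 * (2 ^ clogReal κ * clogReal (1 / ε)) * (230 * nnz Φ) :=
            Nat.mul_le_mul_left _ (by omega)
        _ = _ := by ring
  have hLn : Nat.clog 2 n = clogReal (n : ℝ) := (clogReal_natCast n).symm
  have h1 : Nat.clog 2 (n + 1) ≤ clogReal (n : ℝ) + 1 := by
    refine Nat.clog_le_of_le_pow ?_
    have := Nat.le_pow_clog one_lt_two n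
    rw [hLn] at this
    rw [pow_succ]
    omega
  have hq' : (n : ℝ) ≤ nnz Φ + q := by exact_mod_cast hq
  set t := Real.logb 2 (1 / ε)
  set l := Real.logb 2 (n : ℝ)
  set T := clogReal (1 / ε)
  set L := clogReal (n : ℝ) with hLdef
  set p := nnz Φ
  set m := sketchCount c n ε
  set k := degree ε κ Φ
  have hnat : n * (40 * Nat.clog 2 (n + 1) + 100) + 20 * T + 20 * L +
        20 * (clogReal κ * p) + m * (k * (200 * p + 30) + 50 * n + 50) + 500 * (m * q) + 300 ≤
      40 * (n * L) + 290 * n + 20 * T + 20 * L + 20 * (clogReal κ * p) +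
        230 * (m * (k * p)) + 100 * (m * n) + 500 * (m * q) := by
    have e1 : n * (40 * Nat.clog 2 (n + 1) + 100) ≤ n * (40 * (L + 1) + 100) :=
      Nat.mul_le_mul_left _ (by omega)
    have e2 : m * (k * (200 * p + 30) + 50 * n + 50) ≤ m * (230 * (k * p) + 100 * n) :=
      Nat.mul_le_mul_left _ (by omega)
    have e3 : n * (40 * (L + 1) + 100) = 40 * (n * L) + 140 * n := by ring
    have e4 : m * (230 * (k * p) + 100 * n) = 230 * (m * (k * p)) + 100 * (m * n) := by ring
    omega
  have hκt : 1 ≤ κ * t := one_le_mul_of_one_le_of_one_le hκ ht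
  have hE : 1 ≤ 1 / ε ^ 2 := by
    rw [le_div_iff₀ (by positivity)]
    nlinarith
  have hεE : 1 / ε ≤ 1 / ε ^ 2 := by
    rw [show (1 / ε ^ 2 : ℝ) = (1 / ε) * (1 / ε) by field_simp]
    exact le_mul_of_one_le_left (by positivity) (by linarith)
  set E := 1 / ε ^ 2
  have hp0 : (0 : ℝ) ≤ p := by positivity
  have hq0 : (0 : ℝ) ≤ q := by positivity
  set S := κ * t * p + q with hS
  have hpS : κ * t * p ≤ S := by linarith
  have hqS : (q : ℝ) ≤ S := by
    have : 0 ≤ κ * t * p := by positivity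
    linarith
  have hnS : (n : ℝ) ≤ S := by
    have : (p : ℝ) ≤ κ * t * p := le_mul_of_one_le_left hp0 hκt
    linarith
  have hS2 : 2 ≤ S := hn'.trans hnS
  have hEl : 1 ≤ E * l := one_le_mul_of_one_le_of_one_le hE hl
  have hSY : S ≤ E * S * l := by
    calc S = 1 * S * 1 := by ring
      _ ≤ E * S * l := by gcongr
  have b1 : (n : ℝ) * L ≤ 2 * (E * S * l) := by
    calc (n : ℝ) * L ≤ S * (2 * l) := by gcongr
      _ = 2 * (1 * S * l) := by ring
      _ ≤ 2 * (E * S * l) := by gcongr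
  have b2 : (T : ℝ) ≤ 2 * (E * S * l) := by
    calc (T : ℝ) ≤ 2 * (E * 1 * 1) := by linarith
      _ ≤ 2 * (E * S * l) := by gcongr; linarith
  have b3 : (L : ℝ) ≤ 2 * (E * S * l) := by
    calc (L : ℝ) ≤ 2 * (1 * 1 * l) := by linarith
      _ ≤ 2 * (E * S * l) := by gcongr; linarith
  have b4 : (clogReal κ : ℝ) * p ≤ 2 * (E * S * l) := by
    calc (clogReal κ : ℝ) * p ≤ (2 * κ) * p := by gcongr
      _ = 2 * (κ * 1 * p) := by ring
      _ ≤ 2 * (κ * t * p) := by gcongr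
      _ ≤ 2 * (E * S * l) := by linarith
  have b5 : (m : ℝ) * (k * p) ≤ 128 * c * (E * S * l) := by
    calc (m : ℝ) * (k * p) ≤ (8 * c * (E * l)) * (16 * (κ * t) * p) := by gcongr
      _ = 128 * c * (E * (κ * t * p) * l) := by ring
      _ ≤ 128 * c * (E * S * l) := by gcongr
  have b6 : (m : ℝ) * n ≤ 8 * c * (E * S * l) := by
    calc (m : ℝ) * n ≤ (8 * c * (E * l)) * S := by gcongr
      _ = _ := by ring
  have b7 : (m : ℝ) * q ≤ 8 * c * (E * S * l) := by
    calc (m : ℝ) * q ≤ (8 * c * (E * l)) * S := by gcongr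
      _ = _ := by ring
  have b8 : 0 ≤ (c : ℝ) * (E * S * l) := by positivity
  have hr := (Nat.cast_le (α := ℝ)).2 hnat
  push_cast at hr ⊢
  linarith

theorem exists_degree_dual (hΦ : Φ.PosSemidef) (hε : 0 < ε) (hε1 : ε ≤ 1 / 2)
    (hnorm : ‖Matrix.toEuclideanCLM (𝕜 := ℝ) Φ‖ ≤ κ) (x : Fin n → ℝ) :
    ∃ w : Fin n → ℝ, (∀ g, x ⬝ᵥ taylorVec Φ (degree ε κ Φ) g = w ⬝ᵥ g) ∧
      (1 - ε / 2) * (x ⬝ᵥ NormedSpace.exp Φ *ᵥ x) ≤ w ⬝ᵥ w ∧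
      w ⬝ᵥ w ≤ x ⬝ᵥ NormedSpace.exp Φ *ᵥ x := by
  by_cases h0 : rowCount Φ = 0
  · obtain rfl := eq_zero_of_rowCount_eq_zero h0
    rw [degree, if_pos h0]
    obtain ⟨w, hw, hww⟩ := exists_taylorVec_dual_zero x
    have : 0 ≤ w ⬝ᵥ w := Finset.sum_nonneg fun j _ => mul_self_nonneg _
    refine ⟨w, hw, ?_, hww.le⟩
    rw [← hww]
    nlinarith
  · have hinv := two_le_inv_of_le_half hε hε1
    have hT1 := one_le_clogReal hinv
    have hdeg : degree ε κ Φ = 4 * (2 ^ clogReal κ * clogReal (1 / ε)) := by rw [degree, if_neg h0]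
    have hK1 : 1 ≤ 2 ^ clogReal κ := Nat.one_le_two_pow
    have hk : 4 * κ ≤ degree ε κ Φ := by
      rw [hdeg]
      push_cast
      have h1 : (1 : ℝ) ≤ clogReal (1 / ε) := by exact_mod_cast hT1
      calc 4 * κ = 4 * (κ * 1) := by ring
        _ ≤ 4 * (2 ^ clogReal κ * clogReal (1 / ε)) := by
          gcongr
          exact le_two_pow_clogReal κ
    -- The extra two halvings give `2^(-k) ≤ ε/4`, and `(1 - ε/4)² ≥ 1 - ε/2`.
    have hkT : clogReal (1 / ε) + 2 ≤ degree ε κ Φ := by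
      rw [hdeg]
      nlinarith
    have hpow : (1 / 2 : ℝ) ^ degree ε κ Φ ≤ ε / 4 := by
      calc (1 / 2 : ℝ) ^ degree ε κ Φ ≤ (1 / 2) ^ (clogReal (1 / ε) + 2) :=
            pow_le_pow_of_le_one (by norm_num) (by norm_num) hkT
        _ = 1 / 2 ^ clogReal (1 / ε) / 4 := by
            rw [pow_add, _root_.one_div_pow]
            ring
        _ ≤ ε / 4 := by
            have := one_div_le_one_div_of_le (by positivity) (le_two_pow_clogReal (1 / ε))
            rw [one_div_one_div] at this
            linarith
    obtain ⟨w, hw, h1, h2⟩ := exists_taylorVec_dual hΦ hnorm hk x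
    refine ⟨w, hw, le_trans ?_ h1, h2⟩
    have hww : 0 ≤ w ⬝ᵥ w := Finset.sum_nonneg fun j _ => mul_self_nonneg _
    refine mul_le_mul_of_nonneg_right ?_ (hww.trans h2)
    nlinarith [sq_nonneg ((1 / 2 : ℝ) ^ degree ε κ Φ)]

/-- The factor `64` cancels the one in the tail, leaving `n^(-(a+b+1))` per column. Then `n^a` pays
for the `q` columns and the last `n` for the factor `2`. -/
theorem failure_bound (a b : ℕ) (hn : 2 ≤ n) (hε : 0 < ε) {q : ℕ} (hq : q ≤ n ^ a) :
    (q : ℝ) * (2 * Real.exp (-(sketchCount (64 * (a + b + 1)) n ε * ε ^ 2 / 64))) ≤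
      1 / (n : ℝ) ^ b := by
  have hn' : (2 : ℝ) ≤ n := by exact_mod_cast hn
  have hn0 : (0 : ℝ) < n := by linarith
  have hm := le_sketchCount hn hε (64 * (a + b + 1))
  have hlog : Real.log n ≤ Real.logb 2 n := by
    rw [Real.logb, le_div_iff₀ (Real.log_pos one_lt_two)]
    exact mul_le_of_le_one_right (Real.log_nonneg (by linarith))
      (by linarith [Real.log_two_lt_d9])
  have hexp : Real.exp (-(sketchCount (64 * (a + b + 1)) n ε * ε ^ 2 / 64)) ≤
      1 / (n : ℝ) ^ (a + b + 1) := by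
    have h1 : ((a + b + 1 : ℕ) : ℝ) * Real.log n ≤
        sketchCount (64 * (a + b + 1)) n ε * ε ^ 2 / 64 := by
      calc ((a + b + 1 : ℕ) : ℝ) * Real.log n ≤ ((a + b + 1 : ℕ) : ℝ) * Real.logb 2 n := by gcongr
        _ = ((64 * (a + b + 1) : ℕ) * (Real.logb 2 n * (1 / ε ^ 2))) * ε ^ 2 / 64 := by
          push_cast
          field_simp
        _ ≤ _ := by gcongr
    calc _ ≤ Real.exp (-(((a + b + 1 : ℕ) : ℝ) * Real.log n)) := Real.exp_le_exp.2 (neg_le_neg h1)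
      _ = _ := by rw [Real.exp_neg, Real.exp_nat_mul, Real.exp_log hn0, one_div]
  have hq' : (q : ℝ) ≤ (n : ℝ) ^ a := by exact_mod_cast hq
  calc (q : ℝ) * (2 * Real.exp (-(sketchCount (64 * (a + b + 1)) n ε * ε ^ 2 / 64)))
      ≤ (n : ℝ) ^ a * (n * (1 / (n : ℝ) ^ (a + b + 1))) := by gcongr
    _ = 1 / (n : ℝ) ^ b := by
      rw [pow_add, pow_add]
      field_simp

end Bounds

end WorkDepth

theorem mainTheorem3 (a b : ℕ) :
    ∃ (bigDotExp : WorkDepth.Expr) (C : ℝ), 0 < C ∧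
      ∀ (n : ℕ) (ε κ : ℝ) (p q : ℕ) (Φ : Matrix (Fin n) (Fin n) ℝ)
        (A : Fin n → Matrix (Fin n) (Fin n) ℝ)
        (r : Fin n → ℕ) (Q : (i : Fin n) → Matrix (Fin n) (Fin (r i)) ℝ),
        2 ≤ n → 0 < ε → ε ≤ 1 / 2 → 1 ≤ κ →
        Φ.PosSemidef → ‖Matrix.toEuclideanCLM (𝕜 := ℝ) Φ‖ ≤ κ →
        (∀ i, A i = Q i * (Q i).transpose) →
        p = WorkDepth.nnz Φ → q = ∑ i, WorkDepth.nnz (Q i) →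
        n ≤ p + q → q ≤ n ^ a →
        ∃ (out : (ℕ → ℝ) → Fin n → ℝ) (work depth : (ℕ → ℝ) → ℕ),
          (∀ ω : ℕ → ℝ,
            WorkDepth.Eval ω bigDotExp (WorkDepth.dotExpInput ε κ Φ Q)
              (.arr n fun i => .real (out ω i)) (work ω) (depth ω) ∧
            (depth ω : ℝ) ≤
              C * (κ * Real.logb 2 n * Real.logb 2 (1 / ε) + Real.logb 2 (Real.logb 2 n)) ∧
            (work ω : ℝ) ≤
              C * (1 / ε ^ 2 * (κ * Real.logb 2 (1 / ε) * p + q) * Real.logb 2 n)) ∧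
          WorkDepth.tapeLaw {ω | ¬ ∀ i : Fin n,
              (1 - ε) * WorkDepth.matDot (NormedSpace.exp Φ) (A i) ≤ out ω i ∧
              out ω i ≤ (1 + ε) * WorkDepth.matDot (NormedSpace.exp Φ) (A i)} ≤
            ENNReal.ofReal (1 / (n : ℝ) ^ b) := by
  set c : ℕ := 64 * (a + b + 1) with hc
  refine ⟨WorkDepth.bigDotExpE c, 100 * a + 50000 * c + 10000, by positivity, ?_⟩
  rintro n ε κ p q Φ A r Q hn hε hε1 hκ hΦ hnorm hA rfl rfl hnpq hq
  have hsymm : Φ.transpose = Φ := by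
    have := hΦ.1
    rwa [Matrix.IsHermitian, Matrix.conjTranspose_eq_transpose_of_trivial] at this
  have hruns := fun ω => WorkDepth.Runs.bigDotExpE (ω := ω) (c := c) (ε := ε) (κ := κ) (Q := Q)
    hsymm (WorkDepth.one_le_sketchCount hn (by omega))
  choose work depth heval hwork hdepth using hruns
  have hn' : (2 : ℝ) ≤ n := by exact_mod_cast hn
  have hl := WorkDepth.one_le_logb_two hn'
  have ht := WorkDepth.one_le_logb_two (WorkDepth.two_le_inv_of_le_half hε hε1)
  refine ⟨_, work, depth, fun ω => ⟨heval ω, ?_, ?_⟩, ?_⟩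
  · refine (Nat.cast_le.2 (hdepth ω)).trans
      ((WorkDepth.depth_bound a c hn hε hε1 hκ hq).trans ?_)
    -- The double logarithm enters only as a nonnegative summand; `depth_bound` does without it.
    have hll : 0 ≤ Real.logb 2 (Real.logb 2 n) := Real.logb_nonneg one_lt_two hl
    gcongr
    · norm_num
    · linarith
  · refine (Nat.cast_le.2 (hwork ω)).trans ((WorkDepth.work_bound c hn hε hε1 hκ hnpq).trans ?_)
    gcongr
    linarith [show (0 : ℝ) ≤ 100 * a by positivity]
  · simp only [hA]
    exact (WorkDepth.sketchDot_tail Q hε hε1 (WorkDepth.exists_degree_dual hΦ hε hε1 hnorm)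
      le_rfl).trans (ENNReal.ofReal_le_ofReal (WorkDepth.failure_bound a b hn hε hq))
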